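/- Let $n\ge 1$, $a,l>0$, $C\in\mathbb R^{n\times n}$, $B,D\in L^2([0,l],\mathbb R^n)$, and consider the coupled system $$u_t=a^2u_{zz}+f(u)+B^{T}(z)x(t),\qquad \dot x=Cx+X(x)+\int_0^lD(z)u(z,t)\,dz,\qquad z\in(0,l),\ t>0,\tag{S}$$ with $x(0)=x_0\in\mathbb R^n$, $u(\cdot,0)=\varphi\in L^2[0,l]$, $u(0,t)=d_1(t)$, $u(l,t)=d_2(t)$, where $d_i\in L^\infty(\mathbb R_+)$, $d_i(0)=0$ and $\dot d_i\in L^\infty(\mathbb R_+)$. Assume that, for some $L,\alpha,\zeta,c_0,\delta_1,\delta_2>0$, $\sigma\in\mathbb R$ and $q\ge 3/2$: 1. $f=f_0+f_1$, $f_0(0)=f_1(0)=0$, $f_0$ is $L$-Lipschitz on $\mathbb R$, $f_1\in C^1(\mathbb R)$, $f_1'(s)<0$ and $sf(s)\le\sigma s^2-\alpha|s|^{2q}$ for $s\neq0$, and $|f_1'(s)|\le c_0(1+|s|^{2q-2})$, $|f_1(s)|\le\zeta|s|^{2q-1}$ for all $s$; $X\in C^1(\mathbb R^n,\mathbb R^n)$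 and $\|X(x)\|\le\delta_2\|x\|^{2q-1}$. 2. $P\in\mathbb R^{n\times n}$ is symmetric positive definite; the boundary value problem $a^2P_{12}''+C^{T}P_{12}=-B-PD$, $P_{12}(0)=P_{12}(l)=0$ is uniquely solvable, that is, the matrix $S(l)$ is invertible, where $S(y)=\sum_{k\ge0}\frac{(-1)^k(y/a)^{2k+1}}{(2k+1)!}(C^{T})^k$; $P_{12}$ is its $H^2$ solution; the matrix $\Pi_1=\begin{pmatrix}1&-\|P_{12}\|_{L^2}\\-\|P_{12}\|_{L^2}&\lambda_{\min}(P)\end{pmatrix}$ is positive definite; and $x^{T}PX(x)\le-\delta_1\|x\|^{2q}$ for all $x\in\mathbb R^n$. 3. $\omega:=2\big(\frac{\pi^2a^2}{l^2}-\|D\|_{L^2}\|P_{12}\|_{L^2}-\sigma\big)>0$, and $$\Omega:=-\Big(C^{T}P+PC-\frac1{a^2}\int_0^l\!\!\int_0^l\big(G(z,\zeta)(B(\zeta)+PD(\zeta))B^{T}(z)+B(z)(B^{T}(\zeta)+D^{T}(\zeta)P)G^{T}(z,\zeta)\big)\,d\zeta\,dz\Big)$$ is positive definite, where $G(z,\xi)=a\,S(\min(z,\xi))\,S(\max(z,\xi)-l)\,S(l)^{-1}$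 is the Green's function of $y''+a^{-2}C^{T}y$ with zero boundary values. 4. $\Xi:=\begin{pmatrix}\omega&-L\|P_{12}\|_{L^2}\\-L\|P_{12}\|_{L^2}&\lambda_{\min}(\Omega)\end{pmatrix}$ is positive definite. 5. There are $\tau_1>\tau_2>0$ with $$\frac{\zeta\|P_{12}\|_{L^1}}{q}\tau_1^{2q}+\frac{\delta_2\|P_{12}\|_{L^2}(2q-1)}{q}\tau_1^{\frac{2q}{2q-1}}=2\delta_1,\qquad \frac{\delta_2\|P_{12}\|_{L^2}l^{q-1}}{q}\tau_2^{-2q}+\frac{\zeta(2q-1)\|P_{12}\|_{L^\infty}}{q}\tau_2^{-\frac{2q}{2q-1}}=2\alpha.$$ Here all norms are over $[0,l]$; for a vector function $g$, $\|g\|_{L^p}=(\sum_k\|g_k\|_{L^p}^p)^{1/p}$ for $p<\infty$ and $\|g\|_{L^\infty}=\max_k\|g_k\|_{L^\infty}$. A weak solution of (S) on $\mathbb R_+$ is a pair $(u,x)$ such that for every $T>0$: $u\in L^2([0,T],H^1[0,l])\cap L^{2q}([0,T],L^{2q}[0,l])\cap C([0,T],L^2[0,l])$ and $x\in C([0,T],\mathbb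 R^n)$; for every $\phi\in C_0^\infty((0,l)\times(0,T))$ $$-\int_0^T\langle u,\phi_t\rangle\,dt=\int_0^T\big(-a^2\langle u_z,\phi_z\rangle+\langle f(u)+B^{T}x(t),\phi\rangle\big)\,dt;$$ the ordinary differential equation holds on $(0,T)$; $x(0)=x_0$; $\|u(\cdot,t)-\varphi\|_{L^2}\to0$ as $t\to0+$; and the boundary conditions hold for almost all $t$. Then weak solutions of (S) are unique in the class $L^2_{\mathrm{loc}}(\mathbb R_+,L^\infty[0,l])\times C(\mathbb R_+,\mathbb R^n)$, and so in particular in $L^2(\mathbb R_+,L^\infty[0,l])\times C(\mathbb R_+,\mathbb R^n)$: if $(u_1,x_1)$ and $(u_2,x_2)$ are two weak solutions in this class with the same $\varphi,x_0,d_1,d_2$, then $u_1(\cdot,t)=u_2(\cdot,t)$ in $L^2[0,l]$ and $x_1(t)=x_2(t)$ for all $t\ge0$. -/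

import Mathlib

open MeasureTheory Set Filter Topology
open scoped ContDiff Matrix

noncomputable section

/-- `ℝⁿ` with the Euclidean norm. -/
abbrev Vec (n : ℕ) : Type := EuclideanSpace ℝ (Fin n)

/-- Lebesgue measure on `[0, l]`. -/
abbrev segMeasure (l : ℝ) : Measure ℝ := volume.restrict (Icc 0 l)

/-- The Hilbert space `L²[0, l]`. -/
abbrev L2 (l : ℝ) : Type := Lp ℝ 2 (segMeasure l)

/-- The norm of `g` in `(L^p[0, l])ⁿ` for finite `p`: the `p`-th root of `∑ₖ ‖gₖ‖_p ^ p`. -/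
def vecLpNorm {n : ℕ} (l p : ℝ) (g : ℝ → Vec n) : ℝ :=
  (∑ k, (eLpNorm (fun z => g z k) (ENNReal.ofReal p) (segMeasure l)).toReal ^ p) ^ (1 / p)

/-- The norm of `g` in `(L^∞[0, l])ⁿ`: the maximum of the `‖gₖ‖_∞`. -/
def vecLinfNorm {n : ℕ} (l : ℝ) (g : ℝ → Vec n) : ℝ :=
  ⨆ k, (eLpNorm (fun z => g z k) ⊤ (segMeasure l)).toReal

/-- The smallest eigenvalue of a symmetric matrix. -/
def lambdaMin {n : ℕ} (A : Matrix (Fin n) (Fin n) ℝ) : ℝ := sInf (spectrum ℝ A)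

/-- A matrix acting on `ℝⁿ`. -/
def act {n : ℕ} (A : Matrix (Fin n) (Fin n) ℝ) (v : Vec n) : Vec n :=
  WithLp.toLp 2 (A *ᵥ v.ofLp)

/-- The (entire) matrix function `(Cᵀ)^{-1/2} sin((y/a) (Cᵀ)^{1/2})`, that is
`∑ₖ (-1)ᵏ (y/a)^{2k+1} / (2k+1)! (Cᵀ)ᵏ`. -/
def sinMat {n : ℕ} (a : ℝ) (C : Matrix (Fin n) (Fin n) ℝ) (y : ℝ) :
    Matrix (Fin n) (Fin n) ℝ :=
  ∑' k : ℕ, ((-1) ^ k * (y / a) ^ (2 * k + 1) / ((2 * k + 1).factorial : ℝ)) • Cᵀ ^ k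

/-- The Green's function of `y'' + a⁻² Cᵀ y` on `[0, l]` with zero boundary values. With
`sin((y/a) (Cᵀ)^{1/2}) = (Cᵀ)^{1/2} * sinMat a C y` it is, for `ξ ≤ z`,
`a sin((Cᵀ)^{1/2} ξ/a) sin((Cᵀ)^{1/2} (z-l)/a) ((Cᵀ)^{1/2} sin((Cᵀ)^{1/2} l/a))⁻¹`,
and the same with `z` and `ξ` exchanged for `z ≤ ξ`; the common factor `Cᵀ` is cancelled. -/
def greenFun {n : ℕ} (a l : ℝ) (C : Matrix (Fin n) (Fin n) ℝ) (z ξ : ℝ) :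
    Matrix (Fin n) (Fin n) ℝ :=
  a • (sinMat a C (min z ξ) * sinMat a C (max z ξ - l) * (sinMat a C l)⁻¹)

/-- `p` is an `H²` solution of the boundary value problem
`a² p'' + Cᵀ p = -B - P D` on `[0, l]`, `p(0) = p(l) = 0`: it is differentiable, and its
derivative `p'` is absolutely continuous with a.e. derivative `-a⁻² (Cᵀ p + B + P D)`. -/
def IsBVPSolution {n : ℕ} (a l : ℝ) (C P : Matrix (Fin n) (Fin n) ℝ) (B D p : ℝ → Vec n) :
    Prop :=
  p 0 = 0 ∧ p l = 0 ∧ ∃ p' : ℝ → Vec n,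
    (∀ z ∈ Icc 0 l, HasDerivWithinAt p (p' z) (Icc 0 l) z) ∧
    ∀ z ∈ Icc 0 l, p' z =
      p' 0 + ∫ s in (0 : ℝ)..z, (-(1 / a ^ 2)) • (act Cᵀ (p s) + B s + act P (D s))

/-- The matrix `Π₁`. -/
def matPi1 {n : ℕ} (l : ℝ) (P : Matrix (Fin n) (Fin n) ℝ) (P12 : ℝ → Vec n) :
    Matrix (Fin 2) (Fin 2) ℝ :=
  !![1, -vecLpNorm l 2 P12; -vecLpNorm l 2 P12, lambdaMin P]

/-- The number `ω`. -/
def omegaNum {n : ℕ} (a l σ : ℝ) (D P12 : ℝ → Vec n) : ℝ :=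
  2 * (Real.pi ^ 2 * a ^ 2 / l ^ 2 - vecLpNorm l 2 D * vecLpNorm l 2 P12 - σ)

/-- The matrix `Ω = -(Cᵀ P + P C - a⁻² ∫∫ (G (B + P D) Bᵀ + B (Bᵀ + Dᵀ P) Gᵀ) dζ dz)`, where
`G = G(z, ζ)`, the second factors are taken at `ζ` and the single `B` at `z`. -/
def matOmega {n : ℕ} (a l : ℝ) (C P : Matrix (Fin n) (Fin n) ℝ) (B D : ℝ → Vec n) :
    Matrix (Fin n) (Fin n) ℝ :=
  -(Cᵀ * P + P * C - (1 / a ^ 2) • Matrix.of fun i j =>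
    ∫ z in (0 : ℝ)..l, ∫ ζ in (0 : ℝ)..l,
      (Matrix.vecMulVec (greenFun a l C z ζ *ᵥ ((B ζ).ofLp + P *ᵥ (D ζ).ofLp)) (B z).ofLp +
        Matrix.vecMulVec (B z).ofLp
          (((B ζ).ofLp + (D ζ).ofLp ᵥ* P) ᵥ* (greenFun a l C z ζ)ᵀ)) i j)

/-- The matrix `Ξ`. -/
def matXi {n : ℕ} (a l L σ : ℝ) (C P : Matrix (Fin n) (Fin n) ℝ) (B D P12 : ℝ → Vec n) :
    Matrix (Fin 2) (Fin 2) ℝ :=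
  !![omegaNum a l σ D P12, -(L * vecLpNorm l 2 P12);
    -(L * vecLpNorm l 2 P12), lambdaMin (matOmega a l C P B D)]

/-- Admissible disturbances: `d ∈ L^∞(ℝ₊)`, `d(0) = 0`, and `d` has a generalized derivative
in `L^∞(ℝ₊)`. -/
def IsDisturbance (d : ℝ → ℝ) : Prop :=
  MemLp d ⊤ (volume.restrict (Ici 0)) ∧ d 0 = 0 ∧
    ∃ d' : ℝ → ℝ, MemLp d' ⊤ (volume.restrict (Ici 0)) ∧
      ∀ t, 0 ≤ t → d t = d 0 + ∫ s in (0 : ℝ)..t, d' s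

/-- `w` is the generalized derivative of `v` on `(0, l)`. -/
def IsWeakDeriv (l : ℝ) (v w : ℝ → ℝ) : Prop :=
  ∀ η : ℝ → ℝ, ContDiff ℝ ∞ η → HasCompactSupport η → tsupport η ⊆ Ioo 0 l →
    ∫ z, v z * deriv η z ∂segMeasure l = -∫ z, w z * η z ∂segMeasure l

/-- `u ∈ L²([0, T], H¹[0, l])` with generalized `z`-derivative `uz`. -/
def MemL2H1 (l T : ℝ) (u uz : ℝ → L2 l) : Prop :=
  MemLp u 2 (volume.restrict (Icc 0 T)) ∧ MemLp uz 2 (volume.restrict (Icc 0 T)) ∧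
    ∀ᵐ t ∂volume.restrict (Icc 0 T), IsWeakDeriv l (u t) (uz t)

/-- `u ∈ L^r([0, T], L^r[0, l])` for `1 ≤ r < ∞` and `u` strongly measurable into `L²[0, l]`
(as `L^r[0, l]` is separable, `u` is then strongly measurable into it). -/
def MemLrLr (l T r : ℝ) (u : ℝ → L2 l) : Prop :=
  AEStronglyMeasurable u (volume.restrict (Icc 0 T)) ∧
    (∀ᵐ t ∂volume.restrict (Icc 0 T), MemLp (u t) (ENNReal.ofReal r) (segMeasure l)) ∧
    ∫⁻ t in Icc 0 T, eLpNorm (u t) (ENNReal.ofReal r) (segMeasure l) ^ r < ⊤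

/-- `u ∈ L²(S, L^∞[0, l])` for a set `S` of times: `u` agrees a.e. on `S` with a strongly
measurable, square integrable map into `L^∞[0, l]`. -/
def MemL2Linf (l : ℝ) (S : Set ℝ) (u : ℝ → L2 l) : Prop :=
  ∃ v : ℝ → Lp ℝ ⊤ (segMeasure l), MemLp v 2 (volume.restrict S) ∧
    ∀ᵐ t ∂volume.restrict S, (v t : ℝ → ℝ) =ᵐ[segMeasure l] (u t : ℝ → ℝ)

/-- Test functions `φ(z, t)` in `C₀^∞([0, T], C₀^∞[0, l])`: smooth functions with compact
support in `(0, l) × (0, T)`. -/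
def IsTestFunction (l T : ℝ) (φ : ℝ → ℝ → ℝ) : Prop :=
  ContDiff ℝ ∞ (Function.uncurry φ) ∧ HasCompactSupport (Function.uncurry φ) ∧
    tsupport (Function.uncurry φ) ⊆ Ioo 0 l ×ˢ Ioo 0 T

/-- `(u, x)` is a weak solution on `[0, T]` of
`u_t = a² u_zz + f(u) + Bᵀ x`, `x' = C x + X(x) + ∫₀ˡ D u dz`,
`x(0) = x₀`, `u(·, 0) = φ₀`, `u(0, t) = d₁(t)`, `u(l, t) = d₂(t)`. Here `u t` is `u(·, t)`. -/
structure IsWeakSolutionOn {n : ℕ} (a l q : ℝ) (C : Matrix (Fin n) (Fin n) ℝ)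
    (B D : ℝ → Vec n) (f : ℝ → ℝ) (X : Vec n → Vec n) (φ₀ : L2 l) (x₀ : Vec n)
    (d₁ d₂ : ℝ → ℝ) (T : ℝ) (u : ℝ → L2 l) (x : ℝ → Vec n) : Prop where
  continuousOn_u : ContinuousOn u (Icc 0 T)
  continuousOn_x : ContinuousOn x (Icc 0 T)
  memLrLr : MemLrLr l T (2 * q) u
  /-- `u ∈ L²([0, T], H¹[0, l])` and the weak form of the parabolic equation -/
  weak : ∃ uz : ℝ → L2 l, MemL2H1 l T u uz ∧
    ∀ φ : ℝ → ℝ → ℝ, IsTestFunction l T φ →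
      -∫ t in Icc 0 T, ∫ z, u t z * deriv (fun s => φ z s) t ∂segMeasure l =
        ∫ t in Icc 0 T,
          (-(a ^ 2) * ∫ z, uz t z * deriv (fun y => φ y t) z ∂segMeasure l) +
            ∫ z, (f (u t z) + inner ℝ (B z) (x t)) * φ z t ∂segMeasure l
  ode : ∀ t ∈ Ioo 0 T,
    HasDerivAt x (act C (x t) + X (x t) + ∫ z, u t z • D z ∂segMeasure l) t
  initial_x : x 0 = x₀
  initial_u : Tendsto (fun t => ‖u t - φ₀‖) (𝓝[>] 0) (𝓝 0)
  /-- boundary values of the continuous representative of `u(·, t)`, for almost all `t` -/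
  boundary : ∀ᵐ t ∂volume.restrict (Icc 0 T), ∃ c : ℝ → ℝ, ContinuousOn c (Icc 0 l) ∧
    (u t : ℝ → ℝ) =ᵐ[segMeasure l] c ∧ c 0 = d₁ t ∧ c l = d₂ t

end

/-! Let `w = u₁ - u₂` and `y = x₁ - x₂`. The boundary data cancel, so `w(·, t)` lies in `H₀¹(0, l)`
for almost all `t`, and `w_t = a² w_zz + g` with `g = f(u₁) - f(u₂) + Bᵀ y`. Formally, testing with
`w` gives `‖w(τ)‖² ≤ 2 ∫∫ g w`. Since `f₀` is `L`-Lipschitz and `f₁` is decreasing, `(f(r) - f(s))(r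
- s) ≤ L (r - s)²`; Young's inequality controls the term with `B`. The components `x₁, x₂` stay in a
ball on `[0, T]`, where `X` is Lipschitz, so `‖y‖²` has a similar bound. Adding both and applying
Grönwall (`eq_zero_of_le_integral`) gives `w = 0`, `y = 0`.

The hard part is `energy_inequality`, because `w` is not an admissible test function: it has no time
derivative in `L²`, and `g` lies only in `L^p`, `p = 2q/(2q-1)`, the dual of the space `L^{2q}`
containing `w`. The argument uses time differences. For almost every `t`, the equation integrated
over `[t-h, t]` may be tested with the fixed function `w(t)` (`increment_identity`), and `‖w(t)‖² -
‖w(t-h)‖² ≤ 2⟨w(t) - w(t-h), w(t)⟩`. Integrated over `t ∈ [0, τ]`, the left side telescopes to the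
integral of `‖w‖²` over the last `h` units of time, and the right side becomes `2 ∫₀ʰ Φ(r) dr`,
where `Φ(r)` collects correlations with time lag `r`. Translations are strongly continuous on `L^p`
for `p < ∞`, so `Φ` is continuous (`continuous_integral_translate_mul`), and `h → 0` yields `‖w(τ)‖²
≤ 2 Φ(0)`. In `Φ(0)` the diffusion term has a favourable sign. -/

/-! ### Weak derivatives in one variable -/

/-- Integration by parts for two indefinite integrals. -/
theorem integral_primitive_mul_add {l c : ℝ} {M N : ℝ → ℝ}
    (hM : IntervalIntegrable M volume 0 l) (hN : IntervalIntegrable N volume 0 l) :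
    ∫ z in (0 : ℝ)..l, (M z * (∫ y in (0 : ℝ)..z, N y) + (c + ∫ y in (0 : ℝ)..z, M y) * N z) =
      (c + ∫ y in (0 : ℝ)..l, M y) * ∫ y in (0 : ℝ)..l, N y := by
  have h0 : (0 : ℝ) ∈ uIcc 0 l := left_mem_uIcc
  have hF : AbsolutelyContinuousOnInterval (fun z => c + ∫ y in (0 : ℝ)..z, M y) 0 l := by
    have h1 : AbsolutelyContinuousOnInterval (fun _ : ℝ => c) 0 l :=
      ContDiffOn.absolutelyContinuousOnInterval contDiffOn_const
    exact h1.add (hM.absolutelyContinuousOnInterval_intervalIntegral h0)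
  have hG := hN.absolutelyContinuousOnInterval_intervalIntegral h0
  have := hF.integral_deriv_mul_eq_sub hG
  simp only [intervalIntegral.integral_same, mul_zero, sub_zero] at this
  rw [← this]
  apply intervalIntegral.integral_congr_ae
  filter_upwards [hM.ae_hasDerivAt_integral, hN.ae_hasDerivAt_integral] with z h1 h2 hz
  have hz' := uIoc_subset_uIcc hz
  rw [((h1 hz' 0 h0).const_add c).deriv, (h2 hz' 0 h0).deriv]

/-- Integrals against `segMeasure` are interval integrals. -/
theorem integral_segMeasure {l : ℝ} (hl : 0 ≤ l) (g : ℝ → ℝ) :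
    ∫ z, g z ∂segMeasure l = ∫ z in (0 : ℝ)..l, g z := by
  rw [intervalIntegral.integral_of_le hl, integral_Icc_eq_integral_Ioc]

theorem intervalIntegrable_of_segMeasure {l : ℝ} (hl : 0 ≤ l) {g : ℝ → ℝ}
    (hg : Integrable g (segMeasure l)) : IntervalIntegrable g volume 0 l :=
  (intervalIntegrable_iff_integrableOn_Icc_of_le hl).2 hg

/-- Subtracting a multiple of such a function makes the mean of any test function zero without
leaving the interval. -/
theorem exists_bump_integral_one {l : ℝ} (hl : 0 < l) :
    ∃ ρ : ℝ → ℝ, ContDiff ℝ ∞ ρ ∧ HasCompactSupport ρ ∧ tsupport ρ ⊆ Ioo 0 l ∧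
      ∫ z, ρ z = 1 := by
  let b : ContDiffBump (l / 2) := ⟨l / 8, l / 4, by positivity, by linarith⟩
  refine ⟨b.normed volume, b.contDiff_normed, b.hasCompactSupport_normed, ?_, b.integral_normed⟩
  rw [b.tsupport_normed_eq, Real.closedBall_eq_Icc]
  intro z hz
  have h1 := hz.1
  have h2 := hz.2
  simp only [b] at h1 h2
  constructor <;> linarith

theorem eq_zero_of_notMem_Ioo {l : ℝ} {η : ℝ → ℝ} (hs : tsupport η ⊆ Ioo 0 l) {z : ℝ}
    (hz : z ∉ Ioo 0 l) : η z = 0 :=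
  image_eq_zero_of_notMem_tsupport fun h => hz (hs h)

theorem integral_eq_intervalIntegral_of_tsupport {l : ℝ} (hl : 0 < l) {η : ℝ → ℝ}
    (hs : tsupport η ⊆ Ioo 0 l) : ∫ z, η z = ∫ z in (0 : ℝ)..l, η z := by
  rw [intervalIntegral.integral_of_le hl.le, ← integral_Icc_eq_integral_Ioc,
    setIntegral_eq_integral_of_forall_compl_eq_zero]
  intro z hz
  exact eq_zero_of_notMem_Ioo hs fun h => hz (Ioo_subset_Icc_self h)

/-- A test function with mean zero is the derivative of a test function. -/
theorem exists_primitive_testFunction {l : ℝ} (hl : 0 < l) {η : ℝ → ℝ} (hη : ContDiff ℝ ∞ η)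
    (hs : tsupport η ⊆ Ioo 0 l) (hc : HasCompactSupport η) (h0 : ∫ z, η z = 0) :
    ∃ θ : ℝ → ℝ, ContDiff ℝ ∞ θ ∧ HasCompactSupport θ ∧ tsupport θ ⊆ Ioo 0 l ∧
      ∀ z, HasDerivAt θ (η z) z := by
  have hcont : Continuous η := hη.continuous
  have hd : ∀ z, HasDerivAt (fun y => ∫ s in (0 : ℝ)..y, η s) (η z) z := fun z =>
    intervalIntegral.integral_hasDerivAt_right (hcont.intervalIntegrable _ _)
      hcont.aestronglyMeasurable.stronglyMeasurableAtFilter hcont.continuousAt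
  have hK : IsCompact (tsupport η) := hc
  obtain ⟨a, b, ha, hb, hab⟩ : ∃ a b, 0 < a ∧ b < l ∧ tsupport η ⊆ Icc a b := by
    by_cases hne : (tsupport η).Nonempty
    · obtain ⟨a, ha, ha'⟩ := hK.exists_isLeast hne
      obtain ⟨b, hb, hb'⟩ := hK.exists_isGreatest hne
      exact ⟨a, b, (hs ha).1, (hs hb).2, fun z hz => ⟨ha' hz, hb' hz⟩⟩
    · rw [not_nonempty_iff_eq_empty] at hne
      -- For empty support the endpoints are arbitrary; `Icc 1 (l - 1)` may itself be empty.
      exact ⟨1, l - 1, one_pos, by linarith, by simp [hne]⟩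
  have hz1 : ∀ z, z < a → (∫ s in (0 : ℝ)..z, η s) = 0 := by
    intro z hz
    have : EqOn η (fun _ => (0 : ℝ)) (uIcc 0 z) := by
      intro s hs'
      apply image_eq_zero_of_notMem_tsupport
      intro h
      have h1 := (hab h).1
      have h2 := (mem_uIcc.1 hs')
      rcases h2 with h2 | h2 <;> linarith [h2.1, h2.2]
    rw [intervalIntegral.integral_congr this]; simp
  -- To the right of the support the primitive equals the total integral, so the zero mean enters
  -- here.
  have hz2 : ∀ z, b < z → (∫ s in (0 : ℝ)..z, η s) = 0 := by
    intro z hz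
    have h3 : (∫ s in (0 : ℝ)..l, η s) = 0 := by
      rw [← integral_eq_intervalIntegral_of_tsupport hl hs, h0]
    have : EqOn η (fun _ => (0 : ℝ)) (uIcc z l) := by
      intro s hs'
      apply image_eq_zero_of_notMem_tsupport
      intro h
      have h1 := (hab h).2
      have h2 := (mem_uIcc.1 hs')
      rcases h2 with h2 | h2 <;> linarith [h2.1, h2.2]
    have h4 : (∫ s in z..l, η s) = 0 := by
      rw [intervalIntegral.integral_congr this]; simp
    rw [← intervalIntegral.integral_add_adjacent_intervals
      (hcont.intervalIntegrable 0 z) (hcont.intervalIntegrable z l), h4, add_zero] at h3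
    exact h3
  have hsupp : tsupport (fun y => ∫ s in (0 : ℝ)..y, η s) ⊆ Icc a b := by
    apply closure_minimal _ isClosed_Icc
    intro z hz
    by_contra hn
    rw [mem_Icc, not_and_or, not_le, not_le] at hn
    rcases hn with hn | hn
    · exact hz (hz1 z hn)
    · exact hz (hz2 z hn)
  refine ⟨_, ?_, ?_, hsupp.trans fun z hz => ⟨ha.trans_le hz.1, hz.2.trans_lt hb⟩, hd⟩
  · rw [contDiff_infty_iff_deriv]
    refine ⟨fun z => (hd z).differentiableAt, ?_⟩
    have : deriv (fun y => ∫ s in (0 : ℝ)..y, η s) = η := funext fun z => (hd z).deriv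
    rw [this]; exact hη
  · exact isCompact_Icc.of_isClosed_subset (isClosed_tsupport _) hsupp

/-- A function with an integrable weak derivative is an indefinite integral. -/
theorem IsWeakDeriv.exists_ae_eq {l : ℝ} (hl : 0 < l) {m k : ℝ → ℝ}
    (hm : Integrable m (segMeasure l)) (hk : Integrable k (segMeasure l))
    (h : IsWeakDeriv l m k) :
    ∃ c : ℝ, ∀ᵐ z ∂segMeasure l, m z = c + ∫ y in (0 : ℝ)..z, k y := by
  obtain ⟨ρ, hρ, hρc, hρs, hρ1⟩ := exists_bump_integral_one hl
  have hkI := intervalIntegrable_of_segMeasure hl.le hk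
  have hmI := intervalIntegrable_of_segMeasure hl.le hm
  set K : ℝ → ℝ := fun z => ∫ y in (0 : ℝ)..z, k y with hKdef
  have hKc : ContinuousOn K (uIcc 0 l) :=
    intervalIntegral.continuousOn_primitive_interval' hkI left_mem_uIcc
  have hKI : IntervalIntegrable K volume 0 l := hKc.intervalIntegrable
  -- Both `m` and `K` have weak derivative `k`, hence `m - K` annihilates derivatives of test
  -- functions, that is, all test functions of mean zero.
  have key : ∀ η θ : ℝ → ℝ, Continuous η → ContDiff ℝ ∞ θ → HasCompactSupport θ →
      tsupport θ ⊆ Ioo 0 l → (∀ z, HasDerivAt θ (η z) z) →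
      ∫ z in (0 : ℝ)..l, (m z - K z) * η z = 0 := by
    intro η θ hη hθ hθc hθs hd
    have h1 := h θ hθ hθc hθs
    have hde : deriv θ = η := funext fun z => (hd z).deriv
    rw [hde, integral_segMeasure hl.le, integral_segMeasure hl.le] at h1
    have hθ0 : θ 0 = 0 := eq_zero_of_notMem_Ioo hθs (by simp)
    have hθl : θ l = 0 := eq_zero_of_notMem_Ioo hθs (by simp)
    have hθint : ∀ z, ∫ y in (0 : ℝ)..z, η y = θ z := by
      intro z
      rw [intervalIntegral.integral_eq_sub_of_hasDerivAt (fun y _ => hd y)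
        (hη.intervalIntegrable _ _), hθ0, sub_zero]
    have h2 := integral_primitive_mul_add (c := 0) hkI (hη.intervalIntegrable 0 l)
    simp only [hθint, zero_add, hθl, mul_zero] at h2
    rw [intervalIntegral.integral_add (hkI.mul_continuousOn hθ.continuous.continuousOn)
      (hKI.mul_continuousOn hη.continuousOn)] at h2
    simp only [sub_mul]
    rw [intervalIntegral.integral_sub (hmI.mul_continuousOn hη.continuousOn)
      (hKI.mul_continuousOn hη.continuousOn)]
    linarith
  set c : ℝ := ∫ z in (0 : ℝ)..l, (m z - K z) * ρ z with hcdef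
  refine ⟨c, ?_⟩
  have hdiffI : IntervalIntegrable (fun z => m z - K z) volume 0 l := hmI.sub hKI
  have hloc : LocallyIntegrableOn (fun z => m z - K z - c) (Ioo 0 l) volume := by
    have : IntegrableOn (fun z => m z - K z - c) (Icc 0 l) volume :=
      (intervalIntegrable_iff_integrableOn_Icc_of_le hl.le).1 (hdiffI.sub intervalIntegrable_const)
    exact (this.mono_set Ioo_subset_Icc_self).locallyIntegrableOn
  have hzero := isOpen_Ioo.ae_eq_zero_of_integral_contDiff_smul_eq_zero hloc (by
    intro η hη hηc hηs
    set e : ℝ := ∫ z, η z with he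
    have hηi : Integrable η := hη.continuous.integrable_of_hasCompactSupport hηc
    have hρi : Integrable ρ := hρ.continuous.integrable_of_hasCompactSupport hρc
    -- Du Bois-Reymond's argument: `η - e ρ` has mean zero, so `m - K` pairs with `η` as it does
    -- with `e ρ`, which gives `c e`.
    have hη' : ContDiff ℝ ∞ (fun z => η z - e * ρ z) := hη.sub (contDiff_const.mul hρ)
    have hs' : tsupport (fun z => η z - e * ρ z) ⊆ tsupport η ∪ tsupport ρ := by
      apply closure_minimal _ ((isClosed_tsupport _).union (isClosed_tsupport _))
      intro z hz
      by_contra hn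
      rw [mem_union, not_or] at hn
      exact hz (by simp [image_eq_zero_of_notMem_tsupport hn.1,
        image_eq_zero_of_notMem_tsupport hn.2])
    have hc' : HasCompactSupport (fun z => η z - e * ρ z) :=
      (hηc.isCompact.union hρc.isCompact).of_isClosed_subset (isClosed_tsupport _) hs'
    obtain ⟨θ, h1, h2, h3, h4⟩ := exists_primitive_testFunction hl hη'
      (hs'.trans (union_subset hηs hρs)) hc' (by
        rw [integral_sub hηi (hρi.const_mul e), integral_const_mul, hρ1]; ring)
    have h5 := key _ θ hη'.continuous h1 h2 h3 h4
    have h6 : ∫ z, η z • (m z - K z - c) = ∫ z in (0 : ℝ)..l, η z • (m z - K z - c) := by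
      rw [intervalIntegral.integral_of_le hl.le, ← integral_Icc_eq_integral_Ioc,
        setIntegral_eq_integral_of_forall_compl_eq_zero]
      intro z hz
      simp [eq_zero_of_notMem_Ioo hηs fun h => hz (Ioo_subset_Icc_self h)]
    have h7 : IntervalIntegrable (fun z => (m z - K z) * η z) volume 0 l :=
      hdiffI.mul_continuousOn hη.continuous.continuousOn
    have h8 : IntervalIntegrable (fun z => (m z - K z) * ρ z) volume 0 l :=
      hdiffI.mul_continuousOn hρ.continuous.continuousOn
    have h9 : ∫ z in (0 : ℝ)..l, (m z - K z) * (η z - e * ρ z) =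
        (∫ z in (0 : ℝ)..l, (m z - K z) * η z) - e * c := by
      rw [hcdef, ← intervalIntegral.integral_const_mul,
        ← intervalIntegral.integral_sub h7 (h8.const_mul e)]
      congr 1; ext z; ring
    have h10 : ∫ z in (0 : ℝ)..l, η z • (m z - K z - c) =
        (∫ z in (0 : ℝ)..l, (m z - K z) * η z) - c * e := by
      rw [he, integral_eq_intervalIntegral_of_tsupport hl hηs,
        ← intervalIntegral.integral_const_mul,
        ← intervalIntegral.integral_sub h7 ((hη.continuous.intervalIntegrable _ _).const_mul c)]
      congr 1; ext z; simp only [smul_eq_mul]; ring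
    rw [h6, h10]
    linarith)
  have : segMeasure l = volume.restrict (Ioo 0 l) := Measure.restrict_congr_set Ioo_ae_eq_Icc.symm
  rw [this, ae_restrict_iff' measurableSet_Ioo]
  filter_upwards [hzero] with z hz hz'
  have := hz hz'
  linarith

/-- Functions continuous on `[0, l]` that agree almost everywhere agree everywhere. -/
theorem eqOn_Icc_of_ae_eq {l : ℝ} (hl : 0 < l) {g h : ℝ → ℝ} (hg : ContinuousOn g (Icc 0 l))
    (hh : ContinuousOn h (Icc 0 l)) (hgh : g =ᵐ[segMeasure l] h) : EqOn g h (Icc 0 l) :=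
  Measure.eqOn_Icc_of_ae_eq volume hl.ne hgh hg hh

/-- Continuity fixes the constant as the value at `0`. This serves in the space variable, to read
off boundary values, and in time, to integrate the weak form. -/
theorem IsWeakDeriv.eq_of_continuousOn {l : ℝ} (hl : 0 < l) {m k : ℝ → ℝ}
    (hm : ContinuousOn m (Icc 0 l)) (hk : Integrable k (segMeasure l))
    (h : IsWeakDeriv l m k) : ∀ z ∈ Icc 0 l, m z = m 0 + ∫ y in (0 : ℝ)..z, k y := by
  obtain ⟨c, hc⟩ := h.exists_ae_eq hl (hm.integrableOn_compact isCompact_Icc) hk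
  have hkI := intervalIntegrable_of_segMeasure hl.le hk
  have hKc : ContinuousOn (fun z => c + ∫ y in (0 : ℝ)..z, k y) (Icc 0 l) := by
    have := intervalIntegral.continuousOn_primitive_interval' hkI left_mem_uIcc
    rw [uIcc_of_le hl.le] at this
    exact continuousOn_const.add this
  have heq := eqOn_Icc_of_ae_eq hl hm hKc hc
  have h0 : m 0 = c := by simpa using heq (left_mem_Icc.2 hl.le)
  intro z hz
  rw [h0]; exact heq hz

/-! ### Joint measurability and continuity of time correlations -/

/-- A strongly measurable map into `L²[0, l]` is represented by a jointly measurable function. -/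
theorem exists_measurable_representative {l : ℝ} {ν : Measure ℝ} {v : ℝ → L2 l}
    (hv : AEStronglyMeasurable v ν) :
    ∃ V : ℝ × ℝ → ℝ, Measurable V ∧
      ∀ᵐ t ∂ν, (v t : ℝ → ℝ) =ᵐ[segMeasure l] fun z => V (t, z) := by
  obtain ⟨v', hv', hvv'⟩ := hv
  -- Classes `v' t` have no canonical point values, but their primitives do: `F` is measurable in
  -- `t` (an inner product with an indicator) and continuous in `z`, hence jointly measurable.
  -- Lebesgue differentiation in `z` then recovers `v'`.
  set F : ℝ → ℝ → ℝ := fun z t => ∫ y in Iic z, v' t y ∂segMeasure l with hF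
  have hint : ∀ t, Integrable (v' t) (segMeasure l) := fun t =>
    (Lp.memLp (v' t)).integrable one_le_two
  have hFm : ∀ z, StronglyMeasurable (F z) := by
    intro z
    have hfin : segMeasure l (Iic z) ≠ ⊤ := measure_ne_top _ _
    have : F z = fun t => inner ℝ (indicatorConstLp 2 measurableSet_Iic hfin (1 : ℝ)) (v' t) := by
      ext t
      rw [L2.inner_indicatorConstLp_one]
    rw [this]
    exact (innerSL ℝ (indicatorConstLp 2 measurableSet_Iic hfin (1 : ℝ))).continuous.comp_stronglyMeasurable hv'
  have hG : ∀ t, Integrable ((Icc 0 l).indicator (v' t)) := fun t =>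
    (integrable_indicator_iff measurableSet_Icc).2 (hint t)
  have hFeq : ∀ z t, F z t = ∫ y in Iic z, (Icc 0 l).indicator (v' t) y := by
    intro z t
    rw [hF]
    simp only [segMeasure]
    rw [Measure.restrict_restrict measurableSet_Iic,
      setIntegral_indicator measurableSet_Icc]
  have hFsub : ∀ a b t, F b t - F a t = ∫ y in a..b, (Icc 0 l).indicator (v' t) y := by
    intro a b t
    rw [hFeq, hFeq, intervalIntegral.integral_Iic_sub_Iic (hG t).integrableOn (hG t).integrableOn]
  have hFc : ∀ t, Continuous fun z => F z t := by
    intro t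
    have : (fun z => F z t) = fun z =>
        F 0 t + ∫ y in (0 : ℝ)..z, (Icc 0 l).indicator (v' t) y := by
      ext z; rw [← hFsub]; ring
    rw [this]
    exact continuous_const.add (intervalIntegral.continuous_primitive
      (fun a b => (hG t).intervalIntegrable) 0)
  have hFjoint : Measurable fun p : ℝ × ℝ => F p.2 p.1 := by
    have h := stronglyMeasurable_uncurry_of_continuous_of_stronglyMeasurable
      (u := fun z t => F z t) (fun t => hFc t) hFm
    exact h.measurable.comp measurable_swap
  -- The `limsup` keeps `V` measurable everywhere, also where the difference quotients do not
  -- converge.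
  set V : ℝ × ℝ → ℝ := fun p =>
    limsup (fun n : ℕ => ((n : ℝ) + 1) * (F (p.2 + 1 / ((n : ℝ) + 1)) p.1 - F p.2 p.1)) atTop with hV
  refine ⟨V, ?_, ?_⟩
  · refine Measurable.limsup fun n => ?_
    have h1 : Measurable fun p : ℝ × ℝ => F (p.2 + 1 / ((n : ℝ) + 1)) p.1 :=
      hFjoint.comp (measurable_fst.prodMk (measurable_snd.add_const _))
    exact (h1.sub hFjoint).const_mul _
  · filter_upwards [hvv'] with t ht
    rw [ht, Filter.EventuallyEq, ae_restrict_iff' measurableSet_Icc]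
    filter_upwards [LocallyIntegrable.ae_hasDerivAt_integral (hG t).locallyIntegrable] with z hz hzI
    have h0 := hz 0
    have h1 : HasDerivAt (fun z => F z t) (v' t z) z := by
      have : (fun z => F z t) = fun z =>
        F 0 t + ∫ y in (0 : ℝ)..z, (Icc 0 l).indicator (v' t) y := by
        ext z; rw [← hFsub]; ring
      rw [this]
      rw [indicator_of_mem hzI] at h0
      exact h0.const_add _
    have h2 := (hasDerivAt_iff_tendsto_slope_zero.1 h1)
    have h3 : Tendsto (fun n : ℕ => 1 / ((n : ℝ) + 1)) atTop (𝓝[≠] 0) := by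
      rw [tendsto_nhdsWithin_iff]
      exact ⟨tendsto_one_div_add_atTop_nhds_zero_nat,
        Eventually.of_forall fun n => by
          simp only [mem_compl_iff, mem_singleton_iff]; positivity⟩
    have h4 := (h2.comp h3).limsup_eq
    rw [hV]
    simp only
    rw [← h4]
    congr 1
    ext n
    simp

/-- Correlations in time of an `L^p` and an `L^{p'}` function are continuous. -/
theorem continuous_integral_translate_mul {p p' : ENNReal} (hp1 : 1 ≤ p) (hp : p ≠ ⊤)
    [hpp : p.HolderConjugate p'] {A B : ℝ × ℝ → ℝ}
    (hA : MemLp A p) (hB : MemLp B p') :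
    Continuous fun r : ℝ => ∫ x : ℝ × ℝ, A (x.1 - r, x.2) * B x := by
  have : Fact (1 ≤ p) := ⟨hp1⟩
  have : Fact (p ≠ ⊤) := ⟨hp⟩
  have : Fact (1 ≤ p') := ⟨ENNReal.HolderConjugate.one_le p' p⟩
  set a : Lp ℝ p (volume : Measure (ℝ × ℝ)) := hA.toLp A
  set b : Lp ℝ p' (volume : Measure (ℝ × ℝ)) := hB.toLp B
  -- The translation group acts strongly continuously on `L^p` for `p < ∞`; the correlation is its
  -- orbit paired with a fixed element of the dual.
  have h1 : Continuous fun r : ℝ =>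
      (DomAddAct.mk ((-r, 0) : ℝ × ℝ) +ᵥ a : Lp ℝ p (volume : Measure (ℝ × ℝ))) := by
    have : Continuous fun r : ℝ => DomAddAct.mk ((-r, 0) : ℝ × ℝ) :=
      DomAddAct.continuous_mk.comp (by fun_prop)
    exact this.vadd continuous_const
  have h2 : Continuous fun g : Lp ℝ p (volume : Measure (ℝ × ℝ)) =>
      ((ContinuousLinearMap.mul ℝ ℝ).lpPairing volume p p') g b :=
    (((ContinuousLinearMap.mul ℝ ℝ).lpPairing volume p p').flip b).continuous
  refine (h2.comp h1).congr fun r => ?_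
  simp only [Function.comp]
  rw [ContinuousLinearMap.lpPairing_eq_integral]
  apply integral_congr_ae
  have h3 := DomAddAct.vadd_Lp_ae_eq (DomAddAct.mk ((-r, 0) : ℝ × ℝ)) a
  have h4 : Measure.QuasiMeasurePreserving (fun x : ℝ × ℝ => ((-r, 0) : ℝ × ℝ) +ᵥ x) volume volume :=
    (measurePreserving_vadd ((-r, 0) : ℝ × ℝ) volume).quasiMeasurePreserving
  have h5 := h4.ae_eq_comp hA.coeFn_toLp
  filter_upwards [h3, h5, hB.coeFn_toLp] with x h3 h5 h6
  rw [h3, h6]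
  simp only [Function.comp, vadd_eq_add] at h5
  have h7 : (DomAddAct.mk.symm (DomAddAct.mk ((-r, 0) : ℝ × ℝ)) +ᵥ x) = (-r, 0) + x := rfl
  simp only [ContinuousLinearMap.mul_apply']
  rw [h7, h5]
  congr 2
  ext <;> simp [sub_eq_neg_add]

/-! ### Testing increments in time with elements of `H₀¹` -/

theorem MemLp.integrable_mul_snd {l : ℝ} {ν : Measure ℝ} [IsFiniteMeasure ν] {Z : ℝ × ℝ → ℝ}
    {ψ : ℝ → ℝ} (hZ : MemLp Z 2 (ν.prod (segMeasure l))) (hψ : MemLp ψ 2 (segMeasure l)) :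
    Integrable (fun x : ℝ × ℝ => Z x * ψ x.2) (ν.prod (segMeasure l)) :=
  MemLp.integrable_mul hZ (hψ.comp_snd ν)

theorem Integrable.mul_bdd_snd {l c : ℝ} {ν : Measure ℝ} [IsFiniteMeasure ν] {g : ℝ × ℝ → ℝ}
    {φ : ℝ → ℝ} (hg : Integrable g (ν.prod (segMeasure l)))
    (hφ : AEStronglyMeasurable φ (segMeasure l)) (hb : ∀ᵐ z ∂segMeasure l, ‖φ z‖ ≤ c) :
    Integrable (fun x : ℝ × ℝ => g x * φ x.2) (ν.prod (segMeasure l)) := by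
  refine hg.mul_bdd (c := c) hφ.comp_snd ?_
  exact Measure.quasiMeasurePreserving_snd.ae hb

/-- The integrated weak form, tested with an arbitrary element of `H₀¹(0, l)`. -/
theorem increment_identity {l a T : ℝ} (hl : 0 < l) {w : ℝ → L2 l} {Z g : ℝ × ℝ → ℝ}
    (hZ : MemLp Z 2 ((volume.restrict (Icc 0 T)).prod (segMeasure l)))
    (hg : Integrable g ((volume.restrict (Icc 0 T)).prod (segMeasure l)))
    (hweak : ∀ η : ℝ → ℝ, ContDiff ℝ ∞ η → HasCompactSupport η → tsupport η ⊆ Ioo 0 l →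
      ∀ t ∈ Icc 0 T, ∫ z, w t z * η z ∂segMeasure l =
        ∫ s in (0 : ℝ)..t, (-(a ^ 2) * (∫ z, Z (s, z) * deriv η z ∂segMeasure l) +
          ∫ z, g (s, z) * η z ∂segMeasure l))
    {s₁ s₂ : ℝ} (hs₁ : 0 ≤ s₁) (hs : s₁ ≤ s₂) (hs₂ : s₂ ≤ T) {ψ : ℝ → ℝ}
    (hψ : MemLp ψ 2 (segMeasure l)) (h0 : ∫ y in (0 : ℝ)..l, ψ y = 0) :
    ∫ z, (w s₂ z - w s₁ z) * (∫ y in (0 : ℝ)..z, ψ y) ∂segMeasure l =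
      ∫ s in s₁..s₂, (-(a ^ 2) * (∫ z, Z (s, z) * ψ z ∂segMeasure l) +
          ∫ z, g (s, z) * (∫ y in (0 : ℝ)..z, ψ y) ∂segMeasure l) := by
  have hT : 0 ≤ T := hs₁.trans (hs.trans hs₂)
  set ν : Measure ℝ := volume.restrict (Ioc s₁ s₂) with hν
  have hsub : Ioc s₁ s₂ ⊆ Icc 0 T := fun s h => ⟨hs₁.trans h.1.le, h.2.trans hs₂⟩
  have hle : ν.prod (segMeasure l) ≤ (volume.restrict (Icc 0 T)).prod (segMeasure l) := by
    rw [hν, segMeasure, Measure.prod_restrict, Measure.prod_restrict]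
    exact Measure.restrict_mono (prod_mono hsub subset_rfl) le_rfl
  have hZ' := hZ.mono_measure hle
  have hg' := hg.mono_measure hle
  set gS : ℝ → ℝ := fun z => ∫ s, g (s, z) ∂ν with hgS
  set ZS : ℝ → ℝ := fun z => ∫ s, Z (s, z) ∂ν with hZS
  have hgSi : Integrable gS (segMeasure l) := hg'.integral_prod_right
  have hZSi : Integrable ZS (segMeasure l) := (hZ'.integrable one_le_two).integral_prod_right
  have fub : ∀ (e : ℝ → ℝ) (φ : ℝ → ℝ), Integrable (fun x : ℝ × ℝ => Z x * e x.2)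
      (ν.prod (segMeasure l)) → Integrable (fun x : ℝ × ℝ => g x * φ x.2) (ν.prod (segMeasure l)) →
      ∫ s in s₁..s₂, (-(a ^ 2) * (∫ z, Z (s, z) * e z ∂segMeasure l) +
          ∫ z, g (s, z) * φ z ∂segMeasure l) =
        -(a ^ 2) * (∫ z, ZS z * e z ∂segMeasure l) + ∫ z, gS z * φ z ∂segMeasure l := by
    intro e φ h1 h2
    rw [intervalIntegral.integral_of_le hs,
      integral_add (h1.integral_prod_left.const_mul _) h2.integral_prod_left, integral_const_mul,
      integral_integral_swap (f := fun s z => Z (s, z) * e z) h1,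
      integral_integral_swap (f := fun s z => g (s, z) * φ z) h2]
    simp only [integral_mul_const, hZS, hgS, hν]
  have hbdd : ∀ η : ℝ → ℝ, Continuous η → HasCompactSupport η → ∃ c, ∀ᵐ z ∂segMeasure l, ‖η z‖ ≤ c :=
    fun η hη hc => (hη.bounded_above_of_compact_support hc).imp fun c h => ae_of_all _ h
  have hwi : ∀ t, Integrable (w t) (segMeasure l) := fun t =>
    (Lp.memLp (w t)).integrable one_le_two
  set M : ℝ → ℝ := fun z => w s₂ z - w s₁ z - gS z with hM
  set N : ℝ → ℝ := fun z => a ^ 2 * ZS z with hN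
  have hMi : Integrable M (segMeasure l) := ((hwi _).sub (hwi _)).sub hgSi
  have hNi : Integrable N (segMeasure l) := hZSi.const_mul _
  -- No approximation of `H₀¹` by test functions is needed: after integration in time the weak form
  -- says that `a² ∫ Z ds` has the integrable weak derivative `w s₂ - w s₁ - ∫ g ds`, so it is
  -- absolutely continuous up to a null set.
  have hwd : IsWeakDeriv l N M := by
    intro η hη hηc hηs
    obtain ⟨c, hc⟩ := hbdd η hη.continuous hηc
    obtain ⟨c', hc'⟩ := hbdd (deriv η) (hη.continuous_deriv (by simp)) hηc.deriv
    have hηm := hη.continuous.aestronglyMeasurable (μ := segMeasure l)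
    have hηm' := (hη.continuous_deriv (by simp)).aestronglyMeasurable (μ := segMeasure l)
    have i1 := Integrable.mul_bdd_snd (hZ.integrable one_le_two) hηm' hc'
    have i2 := Integrable.mul_bdd_snd hg hηm hc
    have hk : IntervalIntegrable (fun s => -(a ^ 2) * (∫ z, Z (s, z) * deriv η z ∂segMeasure l) +
          ∫ z, g (s, z) * η z ∂segMeasure l) volume 0 T := by
      rw [intervalIntegrable_iff_integrableOn_Icc_of_le hT]
      exact (i1.integral_prod_left.const_mul _).add i2.integral_prod_left
    have e1 := hweak η hη hηc hηs s₂ ⟨hs₁.trans hs, hs₂⟩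
    have e2 := hweak η hη hηc hηs s₁ ⟨hs₁, hs.trans hs₂⟩
    have e3 := fub (deriv η) η (i1.mono_measure hle) (i2.mono_measure hle)
    rw [← intervalIntegral.integral_interval_sub_left
      (hk.mono_set (by
        rw [uIcc_of_le hT, uIcc_of_le (hs₁.trans hs)]; exact Icc_subset_Icc le_rfl hs₂))
      (hk.mono_set (by
        rw [uIcc_of_le hT, uIcc_of_le hs₁]; exact Icc_subset_Icc le_rfl (hs.trans hs₂))),
      ← e1, ← e2] at e3
    have b : ∀ {u : ℝ → ℝ}, Integrable u (segMeasure l) →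
      Integrable (fun z => u z * η z) (segMeasure l) := fun hu => hu.mul_bdd hηm hc
    have e4 : ∫ z, M z * η z ∂segMeasure l = (∫ z, w s₂ z * η z ∂segMeasure l) -
        (∫ z, w s₁ z * η z ∂segMeasure l) - ∫ z, gS z * η z ∂segMeasure l := by
      simp only [hM, sub_mul]
      have d : Integrable (fun z => w s₂ z * η z - w s₁ z * η z) (segMeasure l) :=
        (b (hwi _)).sub (b (hwi _))
      rw [integral_sub d (b hgSi), integral_sub (b (hwi _)) (b (hwi _))]
    rw [e4]
    simp only [hN, mul_assoc, integral_const_mul]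
    linarith
  obtain ⟨c, hc⟩ := hwd.exists_ae_eq hl hNi hMi
  have hψi := hψ.integrable one_le_two
  -- The boundary terms vanish because the primitive of `ψ` is zero at `0` and, by `h0`, at `l`.
  have ibp := integral_primitive_mul_add (c := c) (intervalIntegrable_of_segMeasure hl.le hMi)
    (intervalIntegrable_of_segMeasure hl.le hψi)
  rw [h0, mul_zero, ← integral_segMeasure hl.le] at ibp
  have hφc : ContinuousOn (fun z => ∫ y in (0 : ℝ)..z, ψ y) (Icc 0 l) := by
    have := intervalIntegral.continuousOn_primitive_interval'
      (intervalIntegrable_of_segMeasure hl.le hψi) left_mem_uIcc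
    rwa [uIcc_of_le hl.le] at this
  have hφm : AEStronglyMeasurable (fun z => ∫ y in (0 : ℝ)..z, ψ y) (segMeasure l) :=
    hφc.aestronglyMeasurable measurableSet_Icc
  obtain ⟨cφ, hcφ⟩ := isCompact_Icc.exists_bound_of_continuousOn hφc
  have hcφ' : ∀ᵐ z ∂segMeasure l, ‖∫ y in (0 : ℝ)..z, ψ y‖ ≤ cφ :=
    (ae_restrict_iff' measurableSet_Icc).2 (ae_of_all _ hcφ)
  have i1 := MemLp.integrable_mul_snd hZ' hψ
  have i2 := Integrable.mul_bdd_snd hg' hφm hcφ'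
  have b : ∀ {u : ℝ → ℝ}, Integrable u (segMeasure l) →
      Integrable (fun z => u z * ∫ y in (0 : ℝ)..z, ψ y) (segMeasure l) :=
    fun hu => hu.mul_bdd hφm hcφ'
  rw [fub ψ _ i1 i2]
  have i3 : Integrable (fun z => ZS z * ψ z) (segMeasure l) := by
    have := i1.integral_prod_right
    simpa only [integral_mul_const] using this
  have e5 : ∫ z, (M z * (∫ y in (0 : ℝ)..z, ψ y) + N z * ψ z) ∂segMeasure l = 0 := by
    refine Eq.trans ?_ ibp
    apply integral_congr_ae
    filter_upwards [hc] with z hz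
    rw [hz]
  have i4 : Integrable (fun z => N z * ψ z) (segMeasure l) := by
    simp only [hN, mul_assoc]; exact i3.const_mul _
  rw [integral_add (b hMi) i4] at e5
  have e4 : ∫ z, M z * (∫ y in (0 : ℝ)..z, ψ y) ∂segMeasure l =
      (∫ z, (w s₂ z - w s₁ z) * (∫ y in (0 : ℝ)..z, ψ y) ∂segMeasure l) -
        ∫ z, gS z * (∫ y in (0 : ℝ)..z, ψ y) ∂segMeasure l := by
    simp only [hM]
    have d : Integrable (fun z => w s₂ z - w s₁ z) (segMeasure l) := (hwi _).sub (hwi _)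
    rw [← integral_sub (b d) (b hgSi)]
    congr 1; ext z; ring
  have e6 : ∫ z, N z * ψ z ∂segMeasure l = a ^ 2 * ∫ z, ZS z * ψ z ∂segMeasure l := by
    simp only [hN, mul_assoc, integral_const_mul]
  linarith

/-! ### The energy inequality -/

/-- Comparison of two continuous functions through their integrals near `0`. -/
theorem le_of_integral_le {F G : ℝ → ℝ} (hF : Continuous F) (hG : Continuous G)
    (h : ∀ r, 0 < r → ∫ s in (0 : ℝ)..r, F s ≤ ∫ s in (0 : ℝ)..r, G s) : F 0 ≤ G 0 := by
  by_contra! hlt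
  have hev : ∀ᶠ s in 𝓝 (0 : ℝ), G s < F s := hG.continuousAt.eventually_lt hF.continuousAt hlt
  obtain ⟨ε, hε, hball⟩ := Metric.eventually_nhds_iff.1 hev
  have := h (ε / 2) (by positivity)
  have h2 : 0 < ∫ s in (0 : ℝ)..(ε / 2), (F s - G s) := by
    apply intervalIntegral.intervalIntegral_pos_of_pos_on
      ((hF.sub hG).intervalIntegrable _ _) _ (by positivity)
    intro s hs
    have := hball (y := s) (by
      rw [Real.dist_eq, sub_zero, abs_of_pos hs.1]; linarith [hs.2])
    simp only [Pi.sub_apply]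
    linarith
  rw [intervalIntegral.integral_sub (hF.intervalIntegrable _ _) (hG.intervalIntegrable _ _)] at h2
  linarith

section Correlation

variable {p p' : ENNReal} {A B : ℝ × ℝ → ℝ}

theorem integrable_translate_mul (hpp : p.HolderConjugate p')
    (hA : MemLp A p) (hB : MemLp B p') (r : ℝ) :
    Integrable fun x : ℝ × ℝ => A (x.1 - r, x.2) * B x := by
  have hmp : MeasurePreserving (fun x : ℝ × ℝ => (x.1 - r, x.2)) volume volume := by
    have := measurePreserving_add_right (volume : Measure (ℝ × ℝ)) ((-r, 0) : ℝ × ℝ)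
    convert this using 2 with x
    ext <;> simp [sub_eq_add_neg]
  exact MemLp.integrable_mul (p := p) (q := p') (hA.comp_measurePreserving hmp) hB

theorem integral_integral_translate_mul (hpp : p.HolderConjugate p')
    (hA : MemLp A p) (hB : MemLp B p') (r : ℝ) :
    ∫ t, ∫ z, A (t - r, z) * B (t, z) = ∫ x : ℝ × ℝ, A (x.1 - r, x.2) * B x := by
  have h := integrable_translate_mul hpp hA hB r
  rw [Measure.volume_eq_prod] at h ⊢
  rw [integral_prod _ h]

/-- For each lag the integral of the absolute value is finite by Hölder, and it depends continuously
on the lag, so it is integrable over `(0, h]`. This licenses the exchange of lag and time in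
`energy_inequality`. -/
theorem integrable_integral_translate_mul (hp1 : 1 ≤ p) (hp : p ≠ ⊤)
    (hpp : p.HolderConjugate p') (hAm : Measurable A) (hBm : Measurable B)
    (hA : MemLp A p) (hB : MemLp B p') (h : ℝ) :
    Integrable (fun x : ℝ × ℝ => ∫ z, A (x.2 - x.1, z) * B (x.2, z))
      ((volume.restrict (Ioc 0 h)).prod volume) := by
  have hm : Measurable fun q : ℝ × ℝ × ℝ => A (q.2.1 - q.1, q.2.2) * B q.2 :=
    (hAm.comp (by fun_prop)).mul (hBm.comp measurable_snd)
  have h1 : Integrable (fun q : ℝ × ℝ × ℝ => A (q.2.1 - q.1, q.2.2) * B q.2)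
      ((volume.restrict (Ioc 0 h)).prod (volume.prod volume)) := by
    rw [integrable_prod_iff hm.aestronglyMeasurable]
    refine ⟨ae_of_all _ fun r => integrable_translate_mul hpp hA hB r, ?_⟩
    have hc := continuous_integral_translate_mul hp1 hp hA.norm hB.norm
    have : (fun r : ℝ => ∫ y : ℝ × ℝ, ‖A (y.1 - r, y.2) * B y‖ ∂(volume.prod volume)) =
        fun r : ℝ => ∫ x : ℝ × ℝ, ‖A (x.1 - r, x.2)‖ * ‖B x‖ := by
      ext r; simp only [norm_mul]; rfl
    rw [this]
    exact (hc.integrableOn_Icc (a := 0) (b := h)).mono_set Ioc_subset_Icc_self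
  have h2 := (measurePreserving_prodAssoc (volume.restrict (Ioc 0 h)) (volume : Measure ℝ)
    (volume : Measure ℝ)).integrable_comp_of_integrable h1
  exact h2.integral_prod_left

end Correlation

theorem MemLp.indicator_rectangle {l T τ : ℝ} (hτT : τ ≤ T) {p : ENNReal} {A : ℝ × ℝ → ℝ}
    (hA : MemLp A p ((volume.restrict (Icc 0 T)).prod (segMeasure l))) :
    MemLp ((Icc 0 τ ×ˢ Icc 0 l).indicator A) p := by
  rw [memLp_indicator_iff_restrict (measurableSet_Icc.prod measurableSet_Icc),
    Measure.volume_eq_prod, ← Measure.prod_restrict]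
  refine hA.mono_measure ?_
  rw [segMeasure, Measure.prod_restrict, Measure.prod_restrict]
  exact Measure.restrict_mono (prod_mono (Icc_subset_Icc le_rfl hτT) subset_rfl) le_rfl

/-- As `t` is already in `[0, τ]`, the only cut-off in time that survives is the one in `s`. -/
theorem integral_indicator_rectangle_mul {l τ s t : ℝ} (A B : ℝ × ℝ → ℝ) (ht : t ∈ Icc 0 τ) :
    ∫ z, (Icc 0 τ ×ˢ Icc 0 l).indicator A (s, z) * (Icc 0 τ ×ˢ Icc 0 l).indicator B (t, z) =
      (Icc 0 τ).indicator (fun s => ∫ z, A (s, z) * B (t, z) ∂segMeasure l) s := by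
  by_cases hs : s ∈ Icc 0 τ
  · rw [indicator_of_mem hs, ← integral_indicator measurableSet_Icc]
    congr 1; ext z
    by_cases hz : z ∈ Icc 0 l
    · rw [indicator_of_mem (show (s, z) ∈ Icc 0 τ ×ˢ Icc 0 l from ⟨hs, hz⟩),
        indicator_of_mem (show (t, z) ∈ Icc 0 τ ×ˢ Icc 0 l from ⟨ht, hz⟩), indicator_of_mem hz]
    · rw [indicator_of_notMem (fun h : (s, z) ∈ Icc 0 τ ×ˢ Icc 0 l => hz h.2),
        indicator_of_notMem hz, zero_mul]
  · rw [indicator_of_notMem hs]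
    have : ∀ z, (Icc 0 τ ×ˢ Icc 0 l).indicator A (s, z) = 0 := fun z =>
      indicator_of_notMem (fun h : (s, z) ∈ Icc 0 τ ×ˢ Icc 0 l => hs h.1) _
    simp only [this, zero_mul, integral_zero]

/-- Energy inequality for weak solutions of `w_t = a² w_zz + g` with homogeneous initial and
boundary values. -/
theorem energy_inequality {l a T : ℝ} (hl : 0 < l) {p p' : ENNReal} (hp1 : 1 ≤ p) (hp : p ≠ ⊤)
    (hpp : p.HolderConjugate p') {w : ℝ → L2 l} {W Z g : ℝ × ℝ → ℝ}
    (hwc : ContinuousOn w (Icc 0 T)) (hw0 : w 0 = 0)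
    (hWm : Measurable W) (hZm : Measurable Z) (hgm : Measurable g)
    (hW : MemLp W p' ((volume.restrict (Icc 0 T)).prod (segMeasure l)))
    (hZ : MemLp Z 2 ((volume.restrict (Icc 0 T)).prod (segMeasure l)))
    (hg : MemLp g p ((volume.restrict (Icc 0 T)).prod (segMeasure l)))
    (hwW : ∀ᵐ t ∂volume.restrict (Icc 0 T), (w t : ℝ → ℝ) =ᵐ[segMeasure l] fun z => W (t, z))
    (hWZ : ∀ᵐ t ∂volume.restrict (Icc 0 T),
      (∀ᵐ z ∂segMeasure l, W (t, z) = ∫ y in (0 : ℝ)..z, Z (t, y)) ∧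
        ∫ y in (0 : ℝ)..l, Z (t, y) = 0)
    (hweak : ∀ η : ℝ → ℝ, ContDiff ℝ ∞ η → HasCompactSupport η → tsupport η ⊆ Ioo 0 l →
      ∀ t ∈ Icc 0 T, ∫ z, w t z * η z ∂segMeasure l =
        ∫ s in (0 : ℝ)..t, (-(a ^ 2) * (∫ z, Z (s, z) * deriv η z ∂segMeasure l) +
          ∫ z, g (s, z) * η z ∂segMeasure l))
    {τ : ℝ} (hτ : τ ∈ Icc 0 T) :
    ‖w τ‖ ^ 2 ≤ 2 * ∫ s in (0 : ℝ)..τ, ∫ z, g (s, z) * W (s, z) ∂segMeasure l := by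
  -- Extension by zero to the whole plane makes time translations available.
  set R : Set (ℝ × ℝ) := Icc 0 τ ×ˢ Icc 0 l with hR
  have hRm : MeasurableSet R := measurableSet_Icc.prod measurableSet_Icc
  set Zt := R.indicator Z with hZt
  set gt := R.indicator g with hgt
  set Wt := R.indicator W with hWt
  have hZtL : MemLp Zt 2 := MemLp.indicator_rectangle hτ.2 hZ
  have hgtL : MemLp gt p := MemLp.indicator_rectangle hτ.2 hg
  have hWtL : MemLp Wt p' := MemLp.indicator_rectangle hτ.2 hW
  have hZtm : Measurable Zt := hZm.indicator hRm
  have hgtm : Measurable gt := hgm.indicator hRm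
  have hWtm : Measurable Wt := hWm.indicator hRm
  have hgi : Integrable g ((volume.restrict (Icc 0 T)).prod (segMeasure l)) := hg.integrable hp1
  have h22 : ENNReal.HolderConjugate 2 2 := inferInstance
  have h12 : (1 : ENNReal) ≤ 2 := one_le_two
  have h2t : (2 : ENNReal) ≠ ⊤ := ENNReal.ofNat_ne_top
  set Φ : ℝ → ℝ := fun r => -(a ^ 2) * (∫ x : ℝ × ℝ, Zt (x.1 - r, x.2) * Zt x) +
    ∫ x : ℝ × ℝ, gt (x.1 - r, x.2) * Wt x with hΦ
  have hΦc : Continuous Φ :=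
    (continuous_const.mul (continuous_integral_translate_mul h12 h2t hZtL hZtL)).add
      (continuous_integral_translate_mul hp1 hp hgtL hWtL)
  -- the energy, extended by constants
  set v : ℝ → ℝ := fun t => ‖w (max 0 (min t τ))‖ ^ 2 with hv
  have hmem : ∀ t, max 0 (min t τ) ∈ Icc 0 T := fun t =>
    ⟨le_max_left _ _, max_le (hτ.1.trans hτ.2) ((min_le_right _ _).trans hτ.2)⟩
  have hvc : Continuous v := by
    have : Continuous fun t => w (max 0 (min t τ)) :=
      hwc.comp_continuous (by fun_prop) hmem
    exact this.norm.pow 2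
  have hv0 : ∀ t ≤ 0, v t = 0 := by
    intro t ht
    have : max 0 (min t τ) = 0 := max_eq_left ((min_le_left _ _).trans ht)
    simp [hv, this, hw0]
  have hvτ : v τ = ‖w τ‖ ^ 2 := by
    simp only [hv, min_self, max_eq_right hτ.1]
  -- the correlation density
  set K : ℝ × ℝ → ℝ := fun x => -(a ^ 2) * (∫ z, Zt (x.2 - x.1, z) * Zt (x.2, z)) +
    ∫ z, gt (x.2 - x.1, z) * Wt (x.2, z) with hK
  have hKi : ∀ h, Integrable K ((volume.restrict (Ioc 0 h)).prod volume) := fun h =>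
    ((integrable_integral_translate_mul h12 h2t h22 hZtm hZtm hZtL hZtL h).const_mul _).add
      (integrable_integral_translate_mul hp1 hp hpp hgtm hWtm hgtL hWtL h)
  have hKt : ∀ r, ∫ t, K (r, t) = Φ r := by
    intro r
    have i1 : Integrable fun t => ∫ z, Zt (t - r, z) * Zt (t, z) := by
      have := integrable_translate_mul h22 hZtL hZtL r
      rw [Measure.volume_eq_prod] at this
      exact this.integral_prod_left
    have i2 : Integrable fun t => ∫ z, gt (t - r, z) * Wt (t, z) := by
      have := integrable_translate_mul hpp hgtL hWtL r
      rw [Measure.volume_eq_prod] at this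
      exact this.integral_prod_left
    simp only [hK, hΦ]
    rw [integral_add (i1.const_mul _) i2, integral_const_mul,
      integral_integral_translate_mul h22 hZtL hZtL, integral_integral_translate_mul hpp hgtL hWtL]
  have hK0 : ∀ r t, t ∉ Icc 0 τ → K (r, t) = 0 := by
    intro r t ht
    have h1 : ∀ (A : ℝ × ℝ → ℝ) z, R.indicator A (t, z) = 0 := fun A z =>
      indicator_of_notMem (fun h : (t, z) ∈ R => ht h.1) _
    simp [hK, hZt, hWt, h1]
  -- pointwise inequality
  have hZ2 : ∀ᵐ t ∂volume.restrict (Icc 0 T), MemLp (fun z => Z (t, z)) 2 (segMeasure l) := by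
    have h1 := (hZ.integrable_sq).prod_right_ae
    filter_upwards [h1] with t ht
    exact (memLp_two_iff_integrable_sq
      (hZm.comp measurable_prodMk_left).aestronglyMeasurable).2 ht
  have hpt : ∀ h, 0 < h → ∀ᵐ t ∂volume.restrict (Icc 0 τ),
      v t - v (t - h) ≤ 2 * ∫ r in (0 : ℝ)..h, K (r, t) := by
    intro h hh
    have hac : ∀ {q : ℝ → Prop}, (∀ᵐ t ∂volume.restrict (Icc 0 T), q t) →
        ∀ᵐ t ∂volume.restrict (Icc 0 τ), q t := fun hq =>
      ae_mono (Measure.restrict_mono (Icc_subset_Icc le_rfl hτ.2) le_rfl) hq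
    filter_upwards [hac hwW, hac hWZ, hac hZ2, ae_restrict_mem measurableSet_Icc]
      with t h1 h2 h3 ht
    -- An increment reaching back before time zero is cut at `0`; this agrees with `v` being zero
    -- there and with the cut-off by `R`.
    set s₁ := max 0 (t - h) with hs₁
    have hs₁t : s₁ ≤ t := max_le ht.1 (by linarith)
    have hid := increment_identity hl hZ hgi hweak (le_max_left _ _ : 0 ≤ s₁) hs₁t
      (ht.2.trans hτ.2) h3 h2.2
    have hφ : ∀ᵐ z ∂segMeasure l, W (t, z) = ∫ y in (0 : ℝ)..z, Z (t, y) := h2.1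
    set G : ℝ → ℝ := fun s => -(a ^ 2) * (∫ z, Z (s, z) * Z (t, z) ∂segMeasure l) +
      ∫ z, g (s, z) * W (t, z) ∂segMeasure l with hG
    have hid2 : inner ℝ (w t - w s₁) (w t) = ∫ s in s₁..t, G s := by
      have e1 : (∫ s in s₁..t, G s) = ∫ s in s₁..t,
          (-(a ^ 2) * (∫ z, Z (s, z) * Z (t, z) ∂segMeasure l) +
          ∫ z, g (s, z) * (∫ y in (0 : ℝ)..z, Z (t, y)) ∂segMeasure l) := by
        congr 1; ext s
        simp only [hG]
        congr 1
        apply integral_congr_ae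
        filter_upwards [hφ] with z hz
        rw [hz]
      rw [e1, ← hid, L2.inner_def]
      apply integral_congr_ae
      filter_upwards [hφ, h1, Lp.coeFn_sub (w t) (w s₁)] with z hz1 hz2 hz3
      rw [hz3, ← hz1, ← hz2]
      simp [mul_comm, hs₁]
    -- Substitution `s = t - r`; the cut-off to `[0, τ]` turns the lower limit `t - h` into `s₁` and
    -- is inactive at the upper limit.
    have hKG : ∫ r in (0 : ℝ)..h, K (r, t) = ∫ s in s₁..t, G s := by
      have e1 : ∀ r, K (r, t) = (Icc 0 τ).indicator G (t - r) := by
        intro r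
        simp only [hK, hZt, hgt, hWt, hR]
        rw [integral_indicator_rectangle_mul _ _ ht, integral_indicator_rectangle_mul _ _ ht]
        by_cases hr : t - r ∈ Icc 0 τ
        · simp only [indicator_of_mem hr, hG]
        · simp only [indicator_of_notMem hr]; ring
      simp only [e1]
      rw [intervalIntegral.integral_comp_sub_left (fun s => (Icc 0 τ).indicator G s) t, sub_zero,
        intervalIntegral.integral_of_le (by linarith), intervalIntegral.integral_of_le hs₁t,
        ← integral_Icc_eq_integral_Ioc, ← integral_Icc_eq_integral_Ioc,
        setIntegral_indicator measurableSet_Icc, Icc_inter_Icc]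
      congr 2
      rw [hs₁, min_eq_left ht.2]
      congr 1
      exact max_comm _ _
    rw [hKG, ← hid2]
    have ev : v t = ‖w t‖ ^ 2 := by
      simp only [hv, min_eq_left ht.2, max_eq_right ht.1]
    have ev' : v (t - h) = ‖w s₁‖ ^ 2 := by
      have : min (t - h) τ = t - h := min_eq_left (by linarith [ht.2])
      simp only [hv, this, hs₁]
    rw [ev, ev', inner_sub_left, real_inner_self_eq_norm_sq]
    -- `2⟨w t - w s₁, w t⟩ = ‖w t‖² - ‖w s₁‖² + ‖w t - w s₁‖²`, and the last square is dropped.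
    have h5 := norm_sub_sq_real (w s₁) (w t)
    nlinarith [sq_nonneg ‖w s₁ - w t‖]
  -- integrate in `t`
  have hint : ∀ h, 0 < h → ∫ r in (0 : ℝ)..h, v (τ - r) ≤ ∫ r in (0 : ℝ)..h, 2 * Φ r := by
    intro h hh
    have e1 : ∫ r in (0 : ℝ)..h, Φ r = ∫ t in (0 : ℝ)..τ, ∫ r in (0 : ℝ)..h, K (r, t) := by
      simp only [← hKt]
      rw [intervalIntegral.integral_of_le hh.le,
        integral_integral_swap (f := fun r t => K (r, t)) (hKi h),
        intervalIntegral.integral_of_le hτ.1, ← integral_Icc_eq_integral_Ioc,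
        setIntegral_eq_integral_of_forall_compl_eq_zero]
      · simp only [intervalIntegral.integral_of_le hh.le]
      · intro t ht
        simp only [hK0 _ t ht, intervalIntegral.integral_zero]
    have i1 : IntervalIntegrable (fun t => ∫ r in (0 : ℝ)..h, K (r, t)) volume 0 τ := by
      simp only [intervalIntegral.integral_of_le hh.le]
      exact (hKi h).integral_prod_right.intervalIntegrable
    have hvh : Continuous fun t => v (t - h) := hvc.comp (continuous_id.sub continuous_const)
    -- Telescoping: after the shift only the interval `[τ - h, τ]` and the one before `0`, where `v`
    -- vanishes, remain.
    have e2 : ∫ t in (0 : ℝ)..τ, (v t - v (t - h)) = ∫ r in (0 : ℝ)..h, v (τ - r) := by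
      rw [intervalIntegral.integral_sub (hvc.intervalIntegrable _ _) (hvh.intervalIntegrable _ _),
        intervalIntegral.integral_comp_sub_right v h, intervalIntegral.integral_comp_sub_left v τ]
      have c1 := intervalIntegral.integral_add_adjacent_intervals
        (hvc.intervalIntegrable (μ := volume) (0 - h) 0) (hvc.intervalIntegrable 0 (τ - h))
      have c2 := intervalIntegral.integral_add_adjacent_intervals
        (hvc.intervalIntegrable (μ := volume) 0 (τ - h)) (hvc.intervalIntegrable (τ - h) τ)
      have c3 : ∫ t in (0 - h)..0, v t = 0 := by
        rw [intervalIntegral.integral_congr (g := fun _ => (0 : ℝ))]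
        · simp
        · intro t ht
          rw [uIcc_of_le (by linarith)] at ht
          exact hv0 t ht.2
      rw [sub_zero, ← c1, ← c2, c3]; ring
    rw [← e2, intervalIntegral.integral_const_mul, e1, ← intervalIntegral.integral_const_mul]
    exact intervalIntegral.integral_mono_ae_restrict hτ.1
      ((hvc.sub hvh).intervalIntegrable _ _) (i1.const_mul 2) (hpt h hh)
  have hfin := le_of_integral_le (F := fun r => v (τ - r)) (G := fun r => 2 * Φ r)
    (hvc.comp (continuous_const.sub continuous_id)) (continuous_const.mul hΦc) hint
  simp only [sub_zero] at hfin
  rw [hvτ] at hfin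
  refine hfin.trans ?_
  -- At lag zero the diffusion contributes `-a² ∫∫ Z²`, which is discarded.
  have h6 : 0 ≤ ∫ x : ℝ × ℝ, Zt (x.1 - 0, x.2) * Zt x := by
    apply integral_nonneg
    intro x
    simp only [sub_zero]
    exact mul_self_nonneg _
  have h7 : ∫ x : ℝ × ℝ, gt (x.1 - 0, x.2) * Wt x =
      ∫ s in (0 : ℝ)..τ, ∫ z, g (s, z) * W (s, z) ∂segMeasure l := by
    rw [← integral_integral_translate_mul hpp hgtL hWtL, intervalIntegral.integral_of_le hτ.1,
      ← integral_Icc_eq_integral_Ioc, ← integral_indicator measurableSet_Icc]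
    congr 1; ext t
    by_cases ht : t ∈ Icc 0 τ
    · simp only [sub_zero, hgt, hWt, hR]
      rw [integral_indicator_rectangle_mul _ _ ht, indicator_of_mem ht, indicator_of_mem ht]
    · have h1 : ∀ z, Wt (t, z) = 0 := fun z =>
        indicator_of_notMem (fun h : (t, z) ∈ R => ht h.1) _
      simp [h1, indicator_of_notMem ht]
  rw [← h7]
  simp only [hΦ]
  nlinarith [sq_nonneg a]

/-! ### Weak solutions as functions of two variables -/

theorem memLp_prod_of_lintegral_eLpNorm {r : ℝ} (hr : 0 < r) {ν μ : Measure ℝ} [SFinite ν]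
    [SFinite μ] {V : ℝ × ℝ → ℝ} (hV : Measurable V)
    (h : ∫⁻ t, eLpNorm (fun z => V (t, z)) (ENNReal.ofReal r) μ ^ r ∂ν < ⊤) :
    MemLp V (ENNReal.ofReal r) (ν.prod μ) := by
  have hr0 : ENNReal.ofReal r ≠ 0 := by simpa using hr
  refine ⟨hV.aestronglyMeasurable, ?_⟩
  rw [eLpNorm_lt_top_iff_lintegral_rpow_enorm_lt_top hr0 ENNReal.ofReal_ne_top,
    ENNReal.toReal_ofReal hr.le, lintegral_prod _ (by fun_prop)]
  convert h using 3 with t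
  rw [eLpNorm_eq_lintegral_rpow_enorm_toReal hr0 ENNReal.ofReal_ne_top,
    ENNReal.toReal_ofReal hr.le, ← ENNReal.rpow_mul, one_div_mul_cancel hr.ne', ENNReal.rpow_one]

theorem IsWeakDeriv.congr_ae {l : ℝ} {v v' k k' : ℝ → ℝ} (h : IsWeakDeriv l v k)
    (hv : v =ᵐ[segMeasure l] v') (hk : k =ᵐ[segMeasure l] k') : IsWeakDeriv l v' k' := by
  intro η h1 h2 h3
  have := h η h1 h2 h3
  have e1 : ∫ z, v z * deriv η z ∂segMeasure l = ∫ z, v' z * deriv η z ∂segMeasure l :=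
    integral_congr_ae (by filter_upwards [hv] with z hz; rw [hz])
  have e2 : ∫ z, k z * η z ∂segMeasure l = ∫ z, k' z * η z ∂segMeasure l :=
    integral_congr_ae (by filter_upwards [hk] with z hz; rw [hz])
  rw [← e1, ← e2, this]

theorem isTestFunction_mul {l T : ℝ} {η θ : ℝ → ℝ} (hη : ContDiff ℝ ∞ η)
    (hηc : HasCompactSupport η) (hηs : tsupport η ⊆ Ioo 0 l) (hθ : ContDiff ℝ ∞ θ)
    (hθc : HasCompactSupport θ) (hθs : tsupport θ ⊆ Ioo 0 T) :
    IsTestFunction l T fun z t => η z * θ t := by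
  have hsub : tsupport (Function.uncurry fun z t => η z * θ t) ⊆ tsupport η ×ˢ tsupport θ := by
    apply closure_minimal _ ((isClosed_tsupport _).prod (isClosed_tsupport _))
    rintro ⟨z, t⟩ hz
    have hz' : η z * θ t ≠ 0 := hz
    exact ⟨subset_tsupport _ (left_ne_zero_of_mul hz'), subset_tsupport _ (right_ne_zero_of_mul hz')⟩
  refine ⟨?_, ?_, hsub.trans (prod_mono hηs hθs)⟩
  · exact (hη.comp contDiff_fst).mul (hθ.comp contDiff_snd)
  · exact (hηc.isCompact.prod hθc.isCompact).of_isClosed_subset (isClosed_tsupport _) hsub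

/-- A superposition operator with growth `|s| + |s|^{2q-1}` maps `L^{2q}` into the dual space. -/
theorem MemLp.comp_of_growth {μ : Measure (ℝ × ℝ)} [IsFiniteMeasure μ] {q L ζ : ℝ}
    (hq : 3 / 2 ≤ q) {f : ℝ → ℝ} (hf : Continuous f)
    (hgrowth : ∀ s, |f s| ≤ L * |s| + ζ * |s| ^ (2 * q - 1)) {U : ℝ × ℝ → ℝ}
    (hU : MemLp U (ENNReal.ofReal (2 * q)) μ) :
    MemLp (fun x => f (U x)) (ENNReal.ofReal (2 * q / (2 * q - 1))) μ := by
  have h1 : 0 < 2 * q - 1 := by linarith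
  have e1 : MemLp (fun x => ‖U x‖) (ENNReal.ofReal (2 * q / (2 * q - 1))) μ := by
    refine hU.norm.mono_exponent (ENNReal.ofReal_le_ofReal ?_)
    rw [div_le_iff₀ h1]
    nlinarith
  -- The power `2q - 1` sends `L^{2q}` exactly into the dual exponent; the linear term is there
  -- because the measure is finite.
  have e2 : MemLp (fun x => ‖U x‖ ^ (2 * q - 1)) (ENNReal.ofReal (2 * q / (2 * q - 1))) μ := by
    have := hU.norm_rpow_div (ENNReal.ofReal (2 * q - 1))
    rwa [ENNReal.toReal_ofReal h1.le, ← ENNReal.ofReal_div_of_pos h1] at this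
  refine ((e1.const_mul L).add (e2.const_mul ζ)).mono
    (hf.comp_aestronglyMeasurable hU.aestronglyMeasurable) (ae_of_all _ fun x => ?_)
  refine (hgrowth (U x)).trans ?_
  simp only [Pi.add_apply, Real.norm_eq_abs]
  exact le_abs_self _

/-- Jointly measurable representatives of the constituents of a weak solution, and the weak
form integrated in time. -/
theorem IsWeakSolutionOn.exists_representation {n : ℕ} {a l q L ζ T : ℝ}
    {C : Matrix (Fin n) (Fin n) ℝ} {B D : ℝ → Vec n} {f : ℝ → ℝ} {X : Vec n → Vec n}
    {φ₀ : L2 l} {x₀ : Vec n} {d₁ d₂ : ℝ → ℝ} {u : ℝ → L2 l} {x : ℝ → Vec n}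
    (hl : 0 < l) (hT : 0 < T) (hq : 3 / 2 ≤ q) (hB : MemLp B 2 (segMeasure l))
    (hf : Continuous f) (hgrowth : ∀ s, |f s| ≤ L * |s| + ζ * |s| ^ (2 * q - 1))
    (hsol : IsWeakSolutionOn a l q C B D f X φ₀ x₀ d₁ d₂ T u x) :
    ∃ U Z F : ℝ × ℝ → ℝ, Measurable U ∧ Measurable Z ∧ Measurable F ∧
      MemLp U (ENNReal.ofReal (2 * q)) ((volume.restrict (Icc 0 T)).prod (segMeasure l)) ∧
      MemLp Z 2 ((volume.restrict (Icc 0 T)).prod (segMeasure l)) ∧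
      MemLp F (ENNReal.ofReal (2 * q / (2 * q - 1)))
        ((volume.restrict (Icc 0 T)).prod (segMeasure l)) ∧
      (∀ᵐ t ∂volume.restrict (Icc 0 T), (u t : ℝ → ℝ) =ᵐ[segMeasure l] fun z => U (t, z)) ∧
      (∀ᵐ t ∂volume.restrict (Icc 0 T), ∀ᵐ z ∂segMeasure l,
        F (t, z) = f (U (t, z)) + inner ℝ (B z) (x t)) ∧
      (∀ᵐ t ∂volume.restrict (Icc 0 T), Integrable (fun z => Z (t, z)) (segMeasure l) ∧
        (∀ᵐ z ∂segMeasure l, U (t, z) = d₁ t + ∫ y in (0 : ℝ)..z, Z (t, y)) ∧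
          d₁ t + ∫ y in (0 : ℝ)..l, Z (t, y) = d₂ t) ∧
      ∀ η : ℝ → ℝ, ContDiff ℝ ∞ η → HasCompactSupport η → tsupport η ⊆ Ioo 0 l →
        IntervalIntegrable (fun s => -(a ^ 2) * (∫ z, Z (s, z) * deriv η z ∂segMeasure l) +
            ∫ z, F (s, z) * η z ∂segMeasure l) volume 0 T ∧
        ∀ t ∈ Icc 0 T, ∫ z, u t z * η z ∂segMeasure l = ∫ z, u 0 z * η z ∂segMeasure l +
          ∫ s in (0 : ℝ)..t, (-(a ^ 2) * (∫ z, Z (s, z) * deriv η z ∂segMeasure l) +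
            ∫ z, F (s, z) * η z ∂segMeasure l) := by
  obtain ⟨uz, ⟨-, huz, hder⟩, hweak⟩ := hsol.weak
  obtain ⟨U, hUm, hU⟩ := exists_measurable_representative hsol.memLrLr.1
  obtain ⟨Z, hZm, hZ⟩ := exists_measurable_representative huz.aestronglyMeasurable
  -- `B` is measurable only up to a null set and `x` is controlled only on `[0, T]`, so both are
  -- replaced by Borel versions to make `F` jointly measurable.
  set B' : ℝ → Vec n := hB.aestronglyMeasurable.mk B with hB'def
  have hBB' : B =ᵐ[segMeasure l] B' := hB.aestronglyMeasurable.ae_eq_mk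
  have hB'm : Measurable B' := hB.aestronglyMeasurable.stronglyMeasurable_mk.measurable
  have hB' : MemLp B' 2 (segMeasure l) := hB.ae_eq hBB'
  set x' : ℝ → Vec n := (Icc 0 T).indicator x with hx'def
  have hx'm : Measurable x' := by
    classical
    rw [hx'def, ← Set.piecewise_eq_indicator]
    exact hsol.continuousOn_x.measurable_piecewise continuousOn_const measurableSet_Icc
  obtain ⟨cx, hcx⟩ := isCompact_Icc.exists_bound_of_continuousOn hsol.continuousOn_x
  have hcx0 : 0 ≤ cx := (norm_nonneg _).trans (hcx 0 ⟨le_rfl, hT.le⟩)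
  have hx'b : ∀ t, ‖x' t‖ ≤ cx := by
    intro t
    by_cases ht : t ∈ Icc 0 T
    · rw [hx'def, indicator_of_mem ht]; exact hcx t ht
    · rw [hx'def, indicator_of_notMem ht, norm_zero]; exact hcx0
  set F : ℝ × ℝ → ℝ := fun y => f (U y) + inner ℝ (B' y.2) (x' y.1) with hF
  have h2q : 0 < 2 * q := by linarith
  have h1 : 0 < 2 * q - 1 := by linarith
  have hUL : MemLp U (ENNReal.ofReal (2 * q))
      ((volume.restrict (Icc 0 T)).prod (segMeasure l)) := by
    apply memLp_prod_of_lintegral_eLpNorm h2q hUm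
    convert hsol.memLrLr.2.2 using 1
    apply lintegral_congr_ae
    filter_upwards [hU] with t ht
    rw [eLpNorm_congr_ae ht]
  have hZL : MemLp Z 2 ((volume.restrict (Icc 0 T)).prod (segMeasure l)) := by
    have h2 : ENNReal.ofReal (2 : ℝ) = 2 := by simp
    rw [← h2]
    apply memLp_prod_of_lintegral_eLpNorm two_pos hZm
    have := (eLpNorm_lt_top_iff_lintegral_rpow_enorm_lt_top (by simp) (by simp)).1 huz.2
    convert this using 1
    apply lintegral_congr_ae
    filter_upwards [hZ] with t ht
    rw [← eLpNorm_congr_ae ht, Lp.enorm_def, h2]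
    simp
  have hBx : MemLp (fun y : ℝ × ℝ => (inner ℝ (B' y.2) (x' y.1) : ℝ))
      (ENNReal.ofReal (2 * q / (2 * q - 1)))
      ((volume.restrict (Icc 0 T)).prod (segMeasure l)) := by
    have e1 : MemLp (fun y : ℝ × ℝ => B' y.2) 2
      ((volume.restrict (Icc 0 T)).prod (segMeasure l)) := hB'.comp_snd _
    have e2 : MemLp (fun y : ℝ × ℝ => (inner ℝ (B' y.2) (x' y.1) : ℝ)) 2
        ((volume.restrict (Icc 0 T)).prod (segMeasure l)) := by
      refine (e1.norm.const_mul cx).mono ?_ (ae_of_all _ fun y => ?_)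
      · exact ((hB'm.comp measurable_snd).inner (hx'm.comp measurable_fst)).aestronglyMeasurable
      · refine (norm_inner_le_norm _ _).trans ?_
        rw [norm_mul, norm_norm, Real.norm_of_nonneg hcx0, mul_comm]
        exact mul_le_mul_of_nonneg_right (hx'b _) (norm_nonneg _)
    refine e2.mono_exponent ?_
    rw [← ENNReal.ofReal_ofNat]
    apply ENNReal.ofReal_le_ofReal
    rw [div_le_iff₀ h1]
    linarith
  have hFm : Measurable F := (hf.measurable.comp hUm).add
    ((hB'm.comp measurable_snd).inner (hx'm.comp measurable_fst))
  have hFL : MemLp F (ENNReal.ofReal (2 * q / (2 * q - 1)))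
      ((volume.restrict (Icc 0 T)).prod (segMeasure l)) :=
    (MemLp.comp_of_growth hq hf hgrowth hUL).add hBx
  have hp1 : 1 ≤ ENNReal.ofReal (2 * q / (2 * q - 1)) := by
    rw [← ENNReal.ofReal_one]
    apply ENNReal.ofReal_le_ofReal
    rw [le_div_iff₀ h1]; linarith
  have hFeq : ∀ᵐ t ∂volume.restrict (Icc 0 T), ∀ᵐ z ∂segMeasure l,
      F (t, z) = f (U (t, z)) + inner ℝ (B z) (x t) := by
    filter_upwards [ae_restrict_mem measurableSet_Icc] with t ht
    filter_upwards [hBB'] with z hz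
    simp only [hF, hx'def, indicator_of_mem ht, hz]
  have hZi : ∀ᵐ t ∂volume.restrict (Icc 0 T), Integrable (fun z => Z (t, z)) (segMeasure l) := by
    filter_upwards [hZ] with t ht
    exact ((Lp.memLp (uz t)).integrable one_le_two).congr ht
  refine ⟨U, Z, F, hUm, hZm, hFm, hUL, hZL, hFL, hU, hFeq, ?_, ?_⟩
  · filter_upwards [hU, hZ, hder, hsol.boundary, hZi] with t h1 h2 h3 h4 h5
    obtain ⟨c, hc, huc, hc0, hcl⟩ := h4
    have h6 := (h3.congr_ae huc h2).eq_of_continuousOn hl hc h5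
    rw [hc0] at h6
    refine ⟨h5, ?_, ?_⟩
    · have h7 : (fun z => U (t, z)) =ᵐ[segMeasure l] c := h1.symm.trans huc
      filter_upwards [h7, ae_restrict_mem measurableSet_Icc] with z hz hzI
      rw [hz, h6 z hzI]
    · rw [← h6 l ⟨hl.le, le_rfl⟩, hcl]
  · intro η hη hηc hηs
    have hηd : Continuous (deriv η) := hη.continuous_deriv (by simp)
    obtain ⟨c, hc⟩ := hη.continuous.bounded_above_of_compact_support hηc
    obtain ⟨c', hc'⟩ := hηd.bounded_above_of_compact_support hηc.deriv
    have i1 := Integrable.mul_bdd_snd (hZL.integrable one_le_two)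
      (hηd.aestronglyMeasurable (μ := segMeasure l)) (ae_of_all _ hc')
    have i2 := Integrable.mul_bdd_snd (hFL.integrable hp1)
      (hη.continuous.aestronglyMeasurable (μ := segMeasure l)) (ae_of_all _ hc)
    have hk : Integrable (fun s => -(a ^ 2) * (∫ z, Z (s, z) * deriv η z ∂segMeasure l) +
        ∫ z, F (s, z) * η z ∂segMeasure l) (segMeasure T) :=
      (i1.integral_prod_left.const_mul _).add i2.integral_prod_left
    have hηL : MemLp η 2 (segMeasure l) :=
      MemLp.of_bound hη.continuous.aestronglyMeasurable c (ae_of_all _ hc)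
    have hm : ContinuousOn (fun t => ∫ z, u t z * η z ∂segMeasure l) (Icc 0 T) := by
      have : (fun t => ∫ z, u t z * η z ∂segMeasure l) = fun t => inner ℝ (hηL.toLp η) (u t) := by
        ext t
        rw [L2.inner_def]
        apply integral_congr_ae
        filter_upwards [hηL.coeFn_toLp] with z hz
        rw [hz]; simp
      rw [this]
      exact continuousOn_const.inner hsol.continuousOn_u
    refine ⟨intervalIntegrable_of_segMeasure hT.le hk, ?_⟩
    -- With time in the role of the space variable: product test functions `η(z) θ(t)` identify the
    -- weak time derivative of the continuous function `t ↦ ⟨u t, η⟩`.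
    refine IsWeakDeriv.eq_of_continuousOn hT hm hk ?_
    intro θ hθ hθc hθs
    have h := hweak _ (isTestFunction_mul hη hηc hηs hθ hθc hθs)
    have e1 : ∀ z t, deriv (fun s => η z * θ s) t = η z * deriv θ t := fun z t =>
      deriv_const_mul _ (hθ.differentiable (by simp) t)
    have e2 : ∀ z t, deriv (fun y => η y * θ t) z = deriv η z * θ t := fun z t =>
      deriv_mul_const (hη.differentiable (by simp) z) _
    simp only [e1, e2, ← mul_assoc, integral_mul_const] at h
    refine (neg_eq_iff_eq_neg.1 h).trans (congrArg Neg.neg (integral_congr_ae ?_))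
    filter_upwards [hU, hZ, hFeq] with t h1 h2 h3
    have e3 : ∫ z, uz t z * deriv η z ∂segMeasure l = ∫ z, Z (t, z) * deriv η z ∂segMeasure l :=
      integral_congr_ae (by filter_upwards [h2] with z hz; rw [hz])
    have e4 : ∫ z, (f (u t z) + inner ℝ (B z) (x t)) * η z ∂segMeasure l =
        ∫ z, F (t, z) * η z ∂segMeasure l :=
      integral_congr_ae (by filter_upwards [h1, h3] with z hz hz3; rw [hz, hz3])
    rw [e3, e4]; ring

/-! ### Grönwall's inequality and bounds for the nonlinear and coupling terms -/

theorem hasDerivAt_primitive_of_mem_Ioo {T t : ℝ} {E : ℝ → ℝ} (hE : ContinuousOn E (Icc 0 T))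
    (ht : t ∈ Ioo 0 T) : HasDerivAt (fun τ => ∫ s in (0 : ℝ)..τ, E s) (E t) t := by
  have hT : 0 ≤ T := (ht.1.trans ht.2).le
  refine intervalIntegral.integral_hasDerivAt_right ?_
    ((hE.mono Ioo_subset_Icc_self).stronglyMeasurableAtFilter isOpen_Ioo t ht)
    (hE.continuousAt (Icc_mem_nhds ht.1 ht.2))
  apply ContinuousOn.intervalIntegrable
  rw [uIcc_of_le ht.1.le]
  exact hE.mono (Icc_subset_Icc le_rfl ht.2.le)

theorem continuousOn_primitive_Icc {T : ℝ} (hT : 0 ≤ T) {E : ℝ → ℝ}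
    (hE : ContinuousOn E (Icc 0 T)) : ContinuousOn (fun τ => ∫ s in (0 : ℝ)..τ, E s) (Icc 0 T) := by
  rw [← uIcc_of_le hT] at hE ⊢
  exact intervalIntegral.continuousOn_primitive_interval' hE.intervalIntegrable left_mem_uIcc

/-- Integral form of Grönwall's inequality with zero initial value. -/
theorem eq_zero_of_le_integral {T K : ℝ} (hK : 0 ≤ K) {E : ℝ → ℝ}
    (hE : ContinuousOn E (Icc 0 T)) (hE0 : ∀ t ∈ Icc 0 T, 0 ≤ E t)
    (h : ∀ t ∈ Icc 0 T, E t ≤ K * ∫ s in (0 : ℝ)..t, E s) : ∀ t ∈ Icc 0 T, E t = 0 := by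
  intro t ht
  have hT : 0 ≤ T := ht.1.trans ht.2
  -- The integrating factor shows that `∫ E` cannot become positive, since it starts at zero.
  have hanti : AntitoneOn (fun t => Real.exp (-K * t) * ∫ s in (0 : ℝ)..t, E s) (Icc 0 T) := by
    have hd : ∀ s ∈ Ioo 0 T, HasDerivAt (fun t => Real.exp (-K * t) * ∫ s in (0 : ℝ)..t, E s)
        (Real.exp (-K * s) * (-K * 1) * (∫ r in (0 : ℝ)..s, E r) + Real.exp (-K * s) * E s) s :=
      fun s hs => (((hasDerivAt_id s).const_mul (-K)).exp).mul
        (hasDerivAt_primitive_of_mem_Ioo hE hs)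
    apply antitoneOn_of_deriv_nonpos (convex_Icc 0 T)
    · exact (Real.continuous_exp.comp (continuous_const.mul continuous_id)).continuousOn.mul
        (continuousOn_primitive_Icc hT hE)
    · rw [interior_Icc]
      exact fun s hs => (hd s hs).differentiableAt.differentiableWithinAt
    · rw [interior_Icc]
      intro s hs
      rw [(hd s hs).deriv]
      have := h s (Ioo_subset_Icc_self hs)
      nlinarith [Real.exp_pos (-K * s)]
  have h1 := hanti (left_mem_Icc.2 hT) ht ht.1
  simp only [intervalIntegral.integral_same, mul_zero] at h1
  have h2 : ∫ s in (0 : ℝ)..t, E s ≤ 0 := by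
    by_contra! hpos
    exact absurd h1 (not_le.2 (mul_pos (Real.exp_pos _) hpos))
  exact le_antisymm ((h t ht).trans (mul_nonpos_of_nonneg_of_nonpos hK h2)) (hE0 t ht)

/-- At the exceptional point the sign of the derivative follows from its continuity and the density
of the complement of `0`. -/
theorem antitone_of_deriv_neg_off_zero {f : ℝ → ℝ} (hf : ContDiff ℝ 1 f)
    (h : ∀ s, s ≠ 0 → deriv f s < 0) : Antitone f := by
  apply antitone_of_deriv_nonpos (hf.differentiable (by simp))
  have hc : Continuous (deriv f) := hf.continuous_deriv le_rfl
  have hcl : IsClosed {s | deriv f s ≤ 0} := isClosed_le hc continuous_const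
  have hd : Dense ({0}ᶜ : Set ℝ) := dense_compl_singleton 0
  intro s
  exact hcl.closure_subset_iff.2 (fun s hs => (h s hs).le) (hd s)

theorem exists_norm_act_le {n : ℕ} (C : Matrix (Fin n) (Fin n) ℝ) :
    ∃ c, 0 ≤ c ∧ ∀ v w : Vec n, ‖act C v - act C w‖ ≤ c * ‖v - w‖ := by
  refine ⟨‖LinearMap.toContinuousLinearMap (Matrix.toEuclideanLin C)‖, norm_nonneg _,
    fun v w => ?_⟩
  have := (LinearMap.toContinuousLinearMap (Matrix.toEuclideanLin C)).le_opNorm (v - w)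
  rw [map_sub] at this
  exact this

theorem exists_lipschitz_on_closedBall {n : ℕ} {X : Vec n → Vec n} (hX : ContDiff ℝ 1 X) (R : ℝ) :
    ∃ c, 0 ≤ c ∧ ∀ v w : Vec n, ‖v‖ ≤ R → ‖w‖ ≤ R → ‖X v - X w‖ ≤ c * ‖v - w‖ := by
  obtain ⟨K, hK⟩ := (isCompact_closedBall (0 : Vec n) R).exists_bound_of_continuousOn
    (hX.continuous_fderiv (by simp)).continuousOn
  refine ⟨max K 0, le_max_right _ _, fun v w hv hw => ?_⟩
  refine (convex_closedBall (0 : Vec n) R).norm_image_sub_le_of_norm_fderiv_le (𝕜 := ℝ)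
    (fun y _ => hX.differentiable (by simp) y) (fun y hy => (hK y hy).trans (le_max_left _ _))
    ?_ ?_
  · simpa using hw
  · simpa using hv

/-- Coupling term `⟨y, ∫ v D dz⟩` estimated by Young's inequality. -/
theorem inner_integral_smul_le {n : ℕ} {l : ℝ} {D : ℝ → Vec n} (hD : MemLp D 2 (segMeasure l))
    (v : L2 l) (y : Vec n) :
    2 * inner ℝ y (∫ z, v z • D z ∂segMeasure l) ≤
      ‖v‖ ^ 2 + ‖y‖ ^ 2 * ∫ z, ‖D z‖ ^ 2 ∂segMeasure l := by
  have hv := Lp.memLp v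
  have hi : Integrable (fun z => v z • D z) (segMeasure l) :=
    memLp_one_iff_integrable.1 (hD.smul hv)
  have hv2 : ‖v‖ ^ 2 = ∫ z, v z ^ 2 ∂segMeasure l := by
    rw [← real_inner_self_eq_norm_sq, L2.inner_def]
    congr 1; ext z; simp [sq]
  rw [← integral_inner hi, hv2, ← integral_const_mul, ← integral_const_mul,
    ← integral_add hv.integrable_sq (hD.norm.integrable_sq.const_mul _)]
  apply integral_mono ((hi.const_inner y).const_mul 2)
    (hv.integrable_sq.add (hD.norm.integrable_sq.const_mul _))
  intro z
  simp only [Pi.add_apply]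
  rw [inner_smul_right]
  have h1 := abs_real_inner_le_norm y (D z)
  have h2 : v z * inner ℝ y (D z) ≤ |v z| * (‖y‖ * ‖D z‖) := by
    refine (le_abs_self _).trans ?_
    rw [abs_mul]
    exact mul_le_mul_of_nonneg_left h1 (abs_nonneg _)
  nlinarith [sq_nonneg (|v z| - ‖y‖ * ‖D z‖), sq_abs (v z)]

theorem holderConjugate_ofReal {q : ℝ} (hq : 3 / 2 ≤ q) :
    (ENNReal.ofReal (2 * q / (2 * q - 1))).HolderConjugate (ENNReal.ofReal (2 * q)) := by
  have h : (2 * q).HolderConjugate (2 * q / (2 * q - 1)) :=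
    Real.HolderConjugate.conjExponent (by linarith)
  exact h.symm.ennrealOfReal

/-! ### Estimates for the difference of two solutions -/

/-- Energy estimate for the difference of two weak solutions: the first component. -/
theorem IsWeakSolutionOn.norm_sub_sq_le {n : ℕ} {a l q L ζ T : ℝ}
    {C : Matrix (Fin n) (Fin n) ℝ} {B D : ℝ → Vec n} {f : ℝ → ℝ} {X : Vec n → Vec n}
    {φ₀ : L2 l} {x₀ : Vec n} {d₁ d₂ : ℝ → ℝ} {u₁ u₂ : ℝ → L2 l} {x₁ x₂ : ℝ → Vec n}
    (hl : 0 < l) (hT : 0 < T) (hq : 3 / 2 ≤ q) (hB : MemLp B 2 (segMeasure l))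
    (hf : Continuous f) (hgrowth : ∀ s, |f s| ≤ L * |s| + ζ * |s| ^ (2 * q - 1))
    (hmono : ∀ r s, (f r - f s) * (r - s) ≤ L * (r - s) ^ 2)
    (hsol₁ : IsWeakSolutionOn a l q C B D f X φ₀ x₀ d₁ d₂ T u₁ x₁)
    (hsol₂ : IsWeakSolutionOn a l q C B D f X φ₀ x₀ d₁ d₂ T u₂ x₂)
    (h0 : u₁ 0 = u₂ 0) {τ : ℝ} (hτ : τ ∈ Icc 0 T) :
    ‖u₁ τ - u₂ τ‖ ^ 2 ≤ ∫ s in (0 : ℝ)..τ, ((2 * L + 1) * ‖u₁ s - u₂ s‖ ^ 2 +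
      (∫ z, ‖B z‖ ^ 2 ∂segMeasure l) * ‖x₁ s - x₂ s‖ ^ 2) := by
  obtain ⟨U₁, Z₁, F₁, hU₁m, hZ₁m, hF₁m, hU₁, hZ₁, hF₁, hr₁, hFf₁, hb₁, hw₁⟩ :=
    hsol₁.exists_representation hl hT hq hB hf hgrowth
  obtain ⟨U₂, Z₂, F₂, hU₂m, hZ₂m, hF₂m, hU₂, hZ₂, hF₂, hr₂, hFf₂, hb₂, hw₂⟩ :=
    hsol₂.exists_representation hl hT hq hB hf hgrowth
  have hq1 : 0 < 2 * q - 1 := by linarith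
  have hp1 : 1 ≤ ENNReal.ofReal (2 * q / (2 * q - 1)) := by
    rw [← ENNReal.ofReal_one]
    apply ENNReal.ofReal_le_ofReal
    rw [le_div_iff₀ hq1]; linarith
  have hpp := holderConjugate_ofReal hq
  have hwW : ∀ᵐ t ∂volume.restrict (Icc 0 T),
      ((u₁ t - u₂ t : L2 l) : ℝ → ℝ) =ᵐ[segMeasure l] fun z => U₁ (t, z) - U₂ (t, z) := by
    filter_upwards [hr₁, hr₂] with t h1 h2
    filter_upwards [h1, h2, Lp.coeFn_sub (u₁ t) (u₂ t)] with z h1 h2 h3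
    rw [h3, Pi.sub_apply, h1, h2]
  have hen := energy_inequality (a := a) (w := fun t => u₁ t - u₂ t)
    (W := fun y => U₁ y - U₂ y) (Z := fun y => Z₁ y - Z₂ y)
    (g := fun y => F₁ y - F₂ y) hl hp1 ENNReal.ofReal_ne_top hpp
    (hsol₁.continuousOn_u.sub hsol₂.continuousOn_u) (by simp [h0]) (hU₁m.sub hU₂m)
    (hZ₁m.sub hZ₂m) (hF₁m.sub hF₂m) (hU₁.sub hU₂) (hZ₁.sub hZ₂) (hF₁.sub hF₂) hwW
    (by
      -- Subtraction removes `d₁` and `d₂`, which leaves zero boundary values.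
      filter_upwards [hb₁, hb₂] with t h1 h2
      have hi1 := intervalIntegrable_of_segMeasure hl.le h1.1
      have hi2 := intervalIntegrable_of_segMeasure hl.le h2.1
      refine ⟨?_, ?_⟩
      · filter_upwards [h1.2.1, h2.2.1, ae_restrict_mem measurableSet_Icc] with z e1 e2 hz
        have hsub : uIcc 0 z ⊆ uIcc 0 l := by
          rw [uIcc_of_le hl.le, uIcc_of_le hz.1]; exact Icc_subset_Icc le_rfl hz.2
        rw [e1, e2, intervalIntegral.integral_sub (hi1.mono_set hsub) (hi2.mono_set hsub)]
        ring
      · rw [intervalIntegral.integral_sub hi1 hi2]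
        linarith [h1.2.2, h2.2.2])
    (by
      intro η hη hηc hηs t ht
      obtain ⟨k1, e1⟩ := hw₁ η hη hηc hηs
      obtain ⟨k2, e2⟩ := hw₂ η hη hηc hηs
      have hsub : uIcc 0 t ⊆ uIcc 0 T := by
        rw [uIcc_of_le hT.le, uIcc_of_le ht.1]; exact Icc_subset_Icc le_rfl ht.2
      have hηd : Continuous (deriv η) := hη.continuous_deriv (by simp)
      obtain ⟨c, hc⟩ := hη.continuous.bounded_above_of_compact_support hηc
      obtain ⟨c', hc'⟩ := hηd.bounded_above_of_compact_support hηc.deriv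
      have b : ∀ {v : ℝ → ℝ}, Integrable v (segMeasure l) →
          Integrable (fun z => v z * η z) (segMeasure l) := fun hv =>
        hv.mul_bdd hη.continuous.aestronglyMeasurable (ae_of_all _ hc)
      have b' : ∀ {v : ℝ → ℝ}, Integrable v (segMeasure l) →
          Integrable (fun z => v z * deriv η z) (segMeasure l) := fun hv =>
        hv.mul_bdd hηd.aestronglyMeasurable (ae_of_all _ hc')
      have hu : ∀ v : L2 l, Integrable v (segMeasure l) := fun v =>
        (Lp.memLp v).integrable one_le_two
      have lhs : ∫ z, (u₁ t - u₂ t : L2 l) z * η z ∂segMeasure l =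
          ∫ z, u₁ t z * η z ∂segMeasure l - ∫ z, u₂ t z * η z ∂segMeasure l := by
        rw [← integral_sub (b (hu _)) (b (hu _))]
        apply integral_congr_ae
        filter_upwards [Lp.coeFn_sub (u₁ t) (u₂ t)] with z hz
        rw [hz, Pi.sub_apply]; ring
      rw [lhs, e1 t ht, e2 t ht, h0, add_sub_add_left_eq_sub,
        ← intervalIntegral.integral_sub (k1.mono_set hsub) (k2.mono_set hsub),
        intervalIntegral.integral_of_le ht.1, intervalIntegral.integral_of_le ht.1]
      apply integral_congr_ae
      have hsub' : Ioc 0 t ⊆ Icc 0 T := fun s hs => ⟨hs.1.le, hs.2.trans ht.2⟩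
      have hac : ∀ {Q : ℝ → Prop}, (∀ᵐ t ∂volume.restrict (Icc 0 T), Q t) →
          ∀ᵐ s ∂volume.restrict (Ioc 0 t), Q s := fun hQ =>
        ae_mono (Measure.restrict_mono hsub' le_rfl) hQ
      filter_upwards [hac hb₁, hac hb₂, hac (hF₁.integrable hp1).prod_right_ae,
        hac (hF₂.integrable hp1).prod_right_ae] with s h1 h2 h3 h4
      simp only [sub_mul]
      rw [integral_sub (b' h1.1) (b' h2.1), integral_sub (b h3) (b h4)]
      ring) hτ
  refine hen.trans ?_
  rw [← intervalIntegral.integral_const_mul]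
  have hWF : Integrable (fun y => (F₁ y - F₂ y) * (U₁ y - U₂ y))
      ((volume.restrict (Icc 0 T)).prod (segMeasure l)) :=
    MemLp.integrable_mul (p := ENNReal.ofReal (2 * q / (2 * q - 1))) (q := ENNReal.ofReal (2 * q))
      (hF₁.sub hF₂) (hU₁.sub hU₂)
  have hsubτ : Icc 0 τ ⊆ Icc 0 T := Icc_subset_Icc le_rfl hτ.2
  apply intervalIntegral.integral_mono_ae_restrict hτ.1
  · rw [intervalIntegrable_iff_integrableOn_Icc_of_le hτ.1]
    exact (IntegrableOn.mono_set (hWF.integral_prod_left) hsubτ).const_mul 2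
  · apply ContinuousOn.intervalIntegrable
    rw [uIcc_of_le hτ.1]
    exact ((continuousOn_const.mul
      ((hsol₁.continuousOn_u.sub hsol₂.continuousOn_u).norm.pow 2)).add
      (continuousOn_const.mul ((hsol₁.continuousOn_x.sub hsol₂.continuousOn_x).norm.pow 2))).mono
      hsubτ
  · have hac : ∀ {Q : ℝ → Prop}, (∀ᵐ t ∂volume.restrict (Icc 0 T), Q t) →
        ∀ᵐ s ∂volume.restrict (Icc 0 τ), Q s := fun hQ =>
      ae_mono (Measure.restrict_mono hsubτ le_rfl) hQ
    filter_upwards [hac hwW, hac hFf₁, hac hFf₂, hac hWF.prod_right_ae] with s h1 h2 h3 h4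
    have hv := Lp.memLp (u₁ s - u₂ s)
    have hv2 : ‖u₁ s - u₂ s‖ ^ 2 = ∫ z, (u₁ s - u₂ s : L2 l) z ^ 2 ∂segMeasure l := by
      rw [← real_inner_self_eq_norm_sq, L2.inner_def]
      congr 1; ext z; simp [sq]
    rw [hv2, mul_comm (∫ z, ‖B z‖ ^ 2 ∂segMeasure l), ← integral_const_mul, ← integral_const_mul,
      ← integral_const_mul, ← integral_add (hv.integrable_sq.const_mul _)
      (hB.norm.integrable_sq.const_mul _)]
    apply integral_mono_ae (h4.const_mul 2)
      ((hv.integrable_sq.const_mul _).add (hB.norm.integrable_sq.const_mul _))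
    filter_upwards [h1, h2, h3] with z e1 e2 e3
    simp only [Pi.add_apply]
    rw [e1, e2, e3]
    have m := hmono (U₁ (s, z)) (U₂ (s, z))
    set r := U₁ (s, z) - U₂ (s, z)
    have h5 : inner ℝ (B z) (x₁ s) - inner ℝ (B z) (x₂ s) = inner ℝ (B z) (x₁ s - x₂ s) :=
      (inner_sub_right _ _ _).symm
    have h6 := abs_real_inner_le_norm (B z) (x₁ s - x₂ s)
    have h7 : inner ℝ (B z) (x₁ s - x₂ s) * r ≤ (‖B z‖ * ‖x₁ s - x₂ s‖) * |r| := by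
      refine (le_abs_self _).trans ?_
      rw [abs_mul]
      exact mul_le_mul_of_nonneg_right h6 (abs_nonneg _)
    have h8 : (f (U₁ (s, z)) + inner ℝ (B z) (x₁ s) - (f (U₂ (s, z)) + inner ℝ (B z) (x₂ s))) * r =
        (f (U₁ (s, z)) - f (U₂ (s, z))) * r + inner ℝ (B z) (x₁ s - x₂ s) * r := by
      rw [← h5]; ring
    rw [h8]
    -- The one-sided Lipschitz bound gives `2L r²`; Young's inequality splits the coupling into `r²`
    -- and `‖B‖² ‖x₁ - x₂‖²`.
    nlinarith [sq_nonneg (‖B z‖ * ‖x₁ s - x₂ s‖ - |r|), sq_abs r]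

/-- Energy estimate for the difference of two weak solutions: the second component. -/
theorem IsWeakSolutionOn.exists_norm_sub_sq_le {n : ℕ} {a l q T : ℝ}
    {C : Matrix (Fin n) (Fin n) ℝ} {B D : ℝ → Vec n} {f : ℝ → ℝ} {X : Vec n → Vec n}
    {φ₀ : L2 l} {x₀ : Vec n} {d₁ d₂ : ℝ → ℝ} {u₁ u₂ : ℝ → L2 l} {x₁ x₂ : ℝ → Vec n}
    (hT : 0 < T) (hD : MemLp D 2 (segMeasure l)) (hX : ContDiff ℝ 1 X)
    (hsol₁ : IsWeakSolutionOn a l q C B D f X φ₀ x₀ d₁ d₂ T u₁ x₁)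
    (hsol₂ : IsWeakSolutionOn a l q C B D f X φ₀ x₀ d₁ d₂ T u₂ x₂) :
    ∃ K, 0 ≤ K ∧ ∀ τ ∈ Icc 0 T, ‖x₁ τ - x₂ τ‖ ^ 2 ≤
      K * ∫ s in (0 : ℝ)..τ, (‖u₁ s - u₂ s‖ ^ 2 + ‖x₁ s - x₂ s‖ ^ 2) := by
  obtain ⟨R₁, hR₁⟩ := isCompact_Icc.exists_bound_of_continuousOn hsol₁.continuousOn_x
  obtain ⟨R₂, hR₂⟩ := isCompact_Icc.exists_bound_of_continuousOn hsol₂.continuousOn_x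
  obtain ⟨cC, hcC0, hcC⟩ := exists_norm_act_le C
  obtain ⟨cX, hcX0, hcX⟩ := exists_lipschitz_on_closedBall hX (max R₁ R₂)
  set δ : ℝ := ∫ z, ‖D z‖ ^ 2 ∂segMeasure l with hδ
  have hδ0 : 0 ≤ δ := integral_nonneg fun z => sq_nonneg _
  -- The first three constants bound the coefficient of `‖y‖²` in the derivative of `‖y‖²`; the `1`
  -- is the coefficient of `‖u₁ - u₂‖²` from the coupling. With this `K`, `‖y‖² - K ∫ E` decreases.
  set K : ℝ := 2 * cC + 2 * cX + δ + 1 with hK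
  have hyc := hsol₁.continuousOn_x.sub hsol₂.continuousOn_x
  have hwc := hsol₁.continuousOn_u.sub hsol₂.continuousOn_u
  set E : ℝ → ℝ := fun s => ‖u₁ s - u₂ s‖ ^ 2 + ‖x₁ s - x₂ s‖ ^ 2 with hE
  have hEc : ContinuousOn E (Icc 0 T) := (hwc.norm.pow 2).add (hyc.norm.pow 2)
  refine ⟨K, by positivity, fun τ hτ => ?_⟩
  have hy0 : x₁ 0 - x₂ 0 = 0 := by rw [hsol₁.initial_x, hsol₂.initial_x, sub_self]
  have hd : ∀ t ∈ Ioo 0 T, HasDerivAt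
      (fun t => ‖x₁ t - x₂ t‖ ^ 2 - K * ∫ s in (0 : ℝ)..t, E s)
      (2 * inner ℝ (x₁ t - x₂ t) (act C (x₁ t) + X (x₁ t) + ∫ z, u₁ t z • D z ∂segMeasure l -
        (act C (x₂ t) + X (x₂ t) + ∫ z, u₂ t z • D z ∂segMeasure l)) - K * E t) t :=
    fun t ht => (((hsol₁.ode t ht).sub (hsol₂.ode t ht)).norm_sq).sub
      ((hasDerivAt_primitive_of_mem_Ioo hEc ht).const_mul K)
  have hanti : AntitoneOn (fun t => ‖x₁ t - x₂ t‖ ^ 2 - K * ∫ s in (0 : ℝ)..t, E s) (Icc 0 T) := by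
    apply antitoneOn_of_deriv_nonpos (convex_Icc 0 T)
    · exact (hyc.norm.pow 2).sub (continuousOn_const.mul (continuousOn_primitive_Icc hT.le hEc))
    · rw [interior_Icc]
      exact fun s hs => (hd s hs).differentiableAt.differentiableWithinAt
    · rw [interior_Icc]
      intro t ht
      rw [(hd t ht).deriv]
      have htI := Ioo_subset_Icc_self ht
      have hi : ∀ v : L2 l, Integrable (fun z => v z • D z) (segMeasure l) := fun v =>
        memLp_one_iff_integrable.1 (hD.smul (Lp.memLp v))
      have e1 : (∫ z, u₁ t z • D z ∂segMeasure l) - ∫ z, u₂ t z • D z ∂segMeasure l =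
          ∫ z, (u₁ t - u₂ t : L2 l) z • D z ∂segMeasure l := by
        rw [← integral_sub (hi _) (hi _)]
        apply integral_congr_ae
        filter_upwards [Lp.coeFn_sub (u₁ t) (u₂ t)] with z hz
        rw [hz, Pi.sub_apply, sub_smul]
      have e2 : act C (x₁ t) + X (x₁ t) + ∫ z, u₁ t z • D z ∂segMeasure l -
          (act C (x₂ t) + X (x₂ t) + ∫ z, u₂ t z • D z ∂segMeasure l) =
          (act C (x₁ t) - act C (x₂ t)) + (X (x₁ t) - X (x₂ t)) +
            ∫ z, (u₁ t - u₂ t : L2 l) z • D z ∂segMeasure l := by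
        rw [← e1]; abel
      rw [e2, inner_add_right, inner_add_right]
      set y := x₁ t - x₂ t with hy
      have h1 := (real_inner_le_norm y (act C (x₁ t) - act C (x₂ t))).trans
        (mul_le_mul_of_nonneg_left (hcC (x₁ t) (x₂ t)) (norm_nonneg y))
      have h2 := (real_inner_le_norm y (X (x₁ t) - X (x₂ t))).trans
        (mul_le_mul_of_nonneg_left (hcX (x₁ t) (x₂ t) ((hR₁ t htI).trans (le_max_left _ _))
          ((hR₂ t htI).trans (le_max_right _ _))) (norm_nonneg y))
      have h3 := inner_integral_smul_le hD (u₁ t - u₂ t) y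
      have h4 : K * E t = (2 * cC + 2 * cX + δ) * ‖u₁ t - u₂ t‖ ^ 2 + ‖u₁ t - u₂ t‖ ^ 2 +
          (2 * cC + 2 * cX + δ) * ‖y‖ ^ 2 + ‖y‖ ^ 2 := by
        simp only [hK, hE]; ring
      have h5 : 0 ≤ (2 * cC + 2 * cX + δ) * ‖u₁ t - u₂ t‖ ^ 2 := by positivity
      rw [h4]
      nlinarith [sq_nonneg ‖y‖]
  have := hanti (left_mem_Icc.2 hT.le) hτ hτ.1
  simp only [hy0, norm_zero, intervalIntegral.integral_same] at this
  linarith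

/-- The initial condition is stated only as a limit from the right; continuity on `[0, T]`
identifies that limit with the value at `0`. -/
theorem IsWeakSolutionOn.initial_eq {n : ℕ} {a l q T : ℝ}
    {C : Matrix (Fin n) (Fin n) ℝ} {B D : ℝ → Vec n} {f : ℝ → ℝ} {X : Vec n → Vec n}
    {φ₀ : L2 l} {x₀ : Vec n} {d₁ d₂ : ℝ → ℝ} {u : ℝ → L2 l} {x : ℝ → Vec n} (hT : 0 < T)
    (hsol : IsWeakSolutionOn a l q C B D f X φ₀ x₀ d₁ d₂ T u x) : u 0 = φ₀ := by
  have h1 : Tendsto u (𝓝[>] 0) (𝓝 φ₀) := tendsto_iff_norm_sub_tendsto_zero.2 hsol.initial_u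
  have h2 : Tendsto u (𝓝[>] 0) (𝓝 (u 0)) := by
    have h3 := (hsol.continuousOn_u 0 (left_mem_Icc.2 hT.le)).mono Ioc_subset_Icc_self
    have h4 : 𝓝[Ioc 0 T] (0 : ℝ) = 𝓝[>] 0 := nhdsWithin_Ioc_eq_nhdsGT hT
    rw [ContinuousWithinAt, h4] at h3
    exact h3
  exact tendsto_nhds_unique h2 h1

/-! ### Uniqueness -/

theorem corollary2 {n : ℕ} (hn : 1 ≤ n) (a l q L σ α ζ c₀ δ₁ δ₂ τ₁ τ₂ : ℝ)
    (C P : Matrix (Fin n) (Fin n) ℝ) (B D P12 : ℝ → Vec n)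
    (f f₀ f₁ : ℝ → ℝ) (X : Vec n → Vec n)
    (ha : 0 < a) (hl : 0 < l)
    (hB : MemLp B 2 (segMeasure l)) (hD : MemLp D 2 (segMeasure l))
    -- standing assumptions on `f` and `X`
    (hf : ∀ s, f s = f₀ s + f₁ s) (hf₀0 : f₀ 0 = 0) (hf₁0 : f₁ 0 = 0)
    (hL : 0 < L) (hf₀ : ∀ s₁ s₂, |f₀ s₂ - f₀ s₁| ≤ L * |s₂ - s₁|)
    (hf₁ : ContDiff ℝ 1 f₁)
    (hα : 0 < α) (hq : 3 / 2 ≤ q)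
    (hdiss : ∀ s, s ≠ 0 → s * f s ≤ σ * s ^ 2 - α * |s| ^ (2 * q))
    (hζ : 0 < ζ) (hc₀ : 0 < c₀)
    (hf₁' : ∀ s, |deriv f₁ s| ≤ c₀ * (1 + |s| ^ (2 * q - 2)))
    (hf₁bd : ∀ s, |f₁ s| ≤ ζ * |s| ^ (2 * q - 1))
    (hX : ContDiff ℝ 1 X) (hδ₂ : 0 < δ₂) (hXbd : ∀ y, ‖X y‖ ≤ δ₂ * ‖y‖ ^ (2 * q - 1))
    (hf₁neg : ∀ s, s ≠ 0 → deriv f₁ s < 0)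
    -- `P` and the solution `P12` of the (uniquely solvable) boundary value problem
    (hP : P.PosDef) (hC : IsUnit (sinMat a C l).det) (hP12 : IsBVPSolution a l C P B D P12)
    (hPi : (matPi1 l P P12).PosDef)
    (hδ₁ : 0 < δ₁) (hPX : ∀ y, inner ℝ y (act P (X y)) ≤ -δ₁ * ‖y‖ ^ (2 * q))
    (hω : 0 < omegaNum a l σ D P12) (hΩ : (matOmega a l C P B D).PosDef)
    (hΞ : (matXi a l L σ C P B D P12).PosDef)
    (hτ₁ : 0 < τ₁) (hτ₂ : 0 < τ₂)
    (hτ₁eq : ζ * vecLpNorm l 1 P12 / q * τ₁ ^ (2 * q) +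
      δ₂ * vecLpNorm l 2 P12 * (2 * q - 1) / q * τ₁ ^ (2 * q / (2 * q - 1)) = 2 * δ₁)
    (hτ₂eq : δ₂ * vecLpNorm l 2 P12 * l ^ (q - 1) / q * τ₂ ^ (-(2 * q)) +
      ζ * (2 * q - 1) * vecLinfNorm l P12 / q * τ₂ ^ (-(2 * q) / (2 * q - 1)) = 2 * α)
    (hτ : τ₂ < τ₁)
    -- initial data and disturbances
    (φ₀ : L2 l) (x₀ : Vec n) (d₁ d₂ : ℝ → ℝ) (hd₁ : IsDisturbance d₁) (hd₂ : IsDisturbance d₂)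
    -- two solutions in the class
    (u₁ u₂ : ℝ → L2 l) (x₁ x₂ : ℝ → Vec n)
    (hsol₁ : ∀ T, 0 < T → IsWeakSolutionOn a l q C B D f X φ₀ x₀ d₁ d₂ T u₁ x₁)
    (hsol₂ : ∀ T, 0 < T → IsWeakSolutionOn a l q C B D f X φ₀ x₀ d₁ d₂ T u₂ x₂)
    (hu₁ : ∀ T, 0 < T → MemL2Linf l (Icc 0 T) u₁)
    (hu₂ : ∀ T, 0 < T → MemL2Linf l (Icc 0 T) u₂)
    (hx₁ : ContinuousOn x₁ (Ici 0)) (hx₂ : ContinuousOn x₂ (Ici 0)) :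
    ∀ t, 0 ≤ t → u₁ t = u₂ t ∧ x₁ t = x₂ t := by
  intro t ht
  -- The horizon must be positive also when `t = 0`.
  set T : ℝ := t + 1 with hTdef
  have hT : 0 < T := by linarith
  have htT : t ∈ Icc 0 T := ⟨ht, by linarith⟩
  have s₁ := hsol₁ T hT
  have s₂ := hsol₂ T hT
  have hf₀c : Continuous f₀ := by
    have : LipschitzWith L.toNNReal f₀ := LipschitzWith.of_dist_le_mul fun r s => by
      rw [Real.coe_toNNReal _ hL.le, Real.dist_eq, Real.dist_eq]
      exact hf₀ s r
    exact this.continuous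
  have hfc : Continuous f := by
    rw [show f = fun s => f₀ s + f₁ s from funext hf]
    exact hf₀c.add hf₁.continuous
  have hgrowth : ∀ s, |f s| ≤ L * |s| + ζ * |s| ^ (2 * q - 1) := by
    intro s
    rw [hf s]
    have h1 := hf₀ 0 s
    rw [hf₀0, sub_zero, sub_zero] at h1
    exact (abs_add_le _ _).trans (add_le_add h1 (hf₁bd s))
  have hanti := antitone_of_deriv_neg_off_zero hf₁ hf₁neg
  have hmono : ∀ r s, (f r - f s) * (r - s) ≤ L * (r - s) ^ 2 := by
    intro r s
    rw [hf r, hf s]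
    have h1 : (f₁ r - f₁ s) * (r - s) ≤ 0 := by
      rcases le_total r s with h | h
      · exact mul_nonpos_of_nonneg_of_nonpos (sub_nonneg.2 (hanti h)) (sub_nonpos.2 h)
      · exact mul_nonpos_of_nonpos_of_nonneg (sub_nonpos.2 (hanti h)) (sub_nonneg.2 h)
    have h2 : (f₀ r - f₀ s) * (r - s) ≤ L * |r - s| * |r - s| := by
      refine (le_abs_self _).trans ?_
      rw [abs_mul]
      exact mul_le_mul_of_nonneg_right (hf₀ s r) (abs_nonneg _)
    have h3 := abs_mul_abs_self (r - s)
    nlinarith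
  have h0 : u₁ 0 = u₂ 0 := (s₁.initial_eq hT).trans (s₂.initial_eq hT).symm
  obtain ⟨K, hK0, hK⟩ := IsWeakSolutionOn.exists_norm_sub_sq_le hT hD hX s₁ s₂
  set β : ℝ := ∫ z, ‖B z‖ ^ 2 ∂segMeasure l with hβ
  have hβ0 : 0 ≤ β := integral_nonneg fun z => sq_nonneg _
  have hwc : ContinuousOn (fun s => ‖u₁ s - u₂ s‖ ^ 2) (Icc 0 T) :=
    (s₁.continuousOn_u.sub s₂.continuousOn_u).norm.pow 2
  have hyc : ContinuousOn (fun s => ‖x₁ s - x₂ s‖ ^ 2) (Icc 0 T) :=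
    (s₁.continuousOn_x.sub s₂.continuousOn_x).norm.pow 2
  -- The two estimates close only together: each bounds one component by the integral of both. `2L +
  -- 1 + β` dominates both coefficients of the first, and `K` comes from the second.
  have hzero := eq_zero_of_le_integral (T := T) (K := 2 * L + 1 + β + K)
    (E := fun s => ‖u₁ s - u₂ s‖ ^ 2 + ‖x₁ s - x₂ s‖ ^ 2) (by positivity) (hwc.add hyc)
    (fun s _ => by positivity) (fun τ hτ' => by
      have h1 := IsWeakSolutionOn.norm_sub_sq_le hl hT hq hB hfc hgrowth hmono s₁ s₂ h0 hτ'
      have h2 := hK τ hτ'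
      have hsub : uIcc 0 τ ⊆ Icc 0 T := by
        rw [uIcc_of_le hτ'.1]; exact Icc_subset_Icc le_rfl hτ'.2
      have h3 : ∫ s in (0 : ℝ)..τ, ((2 * L + 1) * ‖u₁ s - u₂ s‖ ^ 2 + β * ‖x₁ s - x₂ s‖ ^ 2) ≤
          ∫ s in (0 : ℝ)..τ, (2 * L + 1 + β) * (‖u₁ s - u₂ s‖ ^ 2 + ‖x₁ s - x₂ s‖ ^ 2) := by
        apply intervalIntegral.integral_mono_on hτ'.1
        · exact (((continuousOn_const.mul hwc).add
            (continuousOn_const.mul hyc)).mono hsub).intervalIntegrable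
        · exact ((continuousOn_const.mul (hwc.add hyc)).mono hsub).intervalIntegrable
        · intro s _
          nlinarith [mul_nonneg hβ0 (sq_nonneg ‖u₁ s - u₂ s‖),
            mul_nonneg (show 0 ≤ 2 * L + 1 by positivity) (sq_nonneg ‖x₁ s - x₂ s‖)]
      rw [intervalIntegral.integral_const_mul] at h3
      linarith) t htT
  have h1 : ‖u₁ t - u₂ t‖ ^ 2 = 0 := by
    nlinarith [sq_nonneg ‖u₁ t - u₂ t‖, sq_nonneg ‖x₁ t - x₂ t‖]
  have h2 : ‖x₁ t - x₂ t‖ ^ 2 = 0 := by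
    nlinarith [sq_nonneg ‖u₁ t - u₂ t‖, sq_nonneg ‖x₁ t - x₂ t‖]
  exact ⟨sub_eq_zero.1 (norm_eq_zero.1 (pow_eq_zero_iff two_ne_zero |>.1 h1)),
    sub_eq_zero.1 (norm_eq_zero.1 (pow_eq_zero_iff two_ne_zero |>.1 h2))⟩
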